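/- Let $\Gamma\subset\mathbb{R}^3$ be a closed (compact, without boundary), connected, oriented surface of class $C^3$ with unit normal field $n$ (e.g. the outward one). Put $P:=I_3-n\otimes n$, and for $\eta\in C^1(\Gamma)$ let $\underline{D}_i\eta:=\sum_{j=1}^3P_{ij}\,\partial_j\tilde\eta$ on $\Gamma$, where $\tilde\eta$ is any $C^1$ extension of $\eta$ to a neighbourhood of $\Gamma$. For a vector field $v\in C^1(\Gamma)^3$ and a matrix field $A\in C^1(\Gamma)^{3\times3}$ let $$\nabla_\Gamma v:=(\underline{D}_iv_j)_{i,j},\qquad D_\Gamma(v):=P\,\frac{\nabla_\Gamma v+(\nabla_\Gamma v)^T}{2}\,P,\qquad [\mathrm{div}_\Gamma A]_j:=\sum_{i=1}^3\underline{D}_iA_{ij}.$$ Let $C^m(\Gamma,T\Gamma)$ be the space of tangential vector fields of class $C^m$, and let $C^m(\Gamma,T^*\Gamma\otimes T^*\Gamma)$ be the space of fields $S$ of bilinear forms on the tangent planes such that $S(Y,Z)\in C^m(\Gamma)$ for all $Y,Z\in C^m(\Gamma,T\Gamma)$. For $X\in C^1(\Gamma,T\Gamma)$ and tangential $Y,Z$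 let $\overline\nabla_YX:=P(\nabla_\Gamma X)^TY$ be the covariant derivative and $$(\mathrm{Def}\,X)(Y,Z):=\tfrac12\bigl(\overline\nabla_YX\cdot Z+Y\cdot\overline\nabla_ZX\bigr)$$ the deformation tensor. For bilinear forms $S,T$ on the tangent plane $T_y\Gamma$ let $\theta(S,T):=\sum_{i,j=1}^2S(\tau_i,\tau_j)T(\tau_i,\tau_j)$ with an orthonormal basis $\{\tau_1,\tau_2\}$ of $T_y\Gamma$. For $S\in C^1(\Gamma,T^*\Gamma\otimes T^*\Gamma)$ the formal adjoint $\mathrm{Def}^*S\in C(\Gamma,T\Gamma)$ is the continuous tangential vector field with $$\int_\Gamma(\mathrm{Def}^*S)\cdot Y\,d\mathcal{H}^2=\int_\Gamma\theta(S,\mathrm{Def}\,Y)\,d\mathcal{H}^2\qquad\text{for all }Y\in C^1(\Gamma,T\Gamma).$$ **Lemma.** Let $g\in C^1(\Gamma)$ and $X\in C^2(\Gamma,T\Gamma)$. Then $gD_\Gamma(X)\in C^1(\Gamma)^{3\times3}$, $g\,\mathrm{Def}\,X\in C^1(\Gamma,T^*\Gamma\otimes T^*\Gamma)$, the field $\mathrm{Def}^*(g\,\mathrm{Def}\,X)$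 exists and is unique, and $$P\,\mathrm{div}_\Gamma[gD_\Gamma(X)]=-\mathrm{Def}^*(g\,\mathrm{Def}\,X)\quad\text{on }\Gamma.$$ -/

import Mathlib

open MeasureTheory Topology
open scoped Matrix Gradient

noncomputable section

/-- Euclidean three-space. -/
abbrev E3 : Type := EuclideanSpace ℝ (Fin 3)

/-- A closed (compact, without boundary), connected, oriented surface of class `C³` in `ℝ³`,
together with its unit normal field: near each of its points the surface is the zero set of a
`C³` function `f` without critical points, and there the normal is `∇f / |∇f|`.  Either
orientation is allowed, in particular the one given by the outward normal. -/
structure ClosedSurface where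
  carrier : Set E3
  isCompact : IsCompact carrier
  isConnected : IsConnected carrier
  normal : carrier → E3
  exists_local_equation : ∀ y : carrier, ∃ (V : Set E3) (f : E3 → ℝ),
    IsOpen V ∧ (y : E3) ∈ V ∧ ContDiffOn ℝ 3 f V ∧ (∀ x ∈ V, ∇ f x ≠ 0) ∧
    (∀ x ∈ V, x ∈ carrier ↔ f x = 0) ∧
    (∀ x : carrier, (x : E3) ∈ V → normal x = ‖∇ f x‖⁻¹ • ∇ f x)

namespace ClosedSurface

instance : CoeSort ClosedSurface Type := ⟨fun Γ => Γ.carrier⟩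

variable (Γ : ClosedSurface)

/-- The two-dimensional Hausdorff measure (normalised to be the area on planes) on the surface. -/
def area : Measure Γ := (μHE[2] : Measure E3).comap Subtype.val

/-- `η ∈ C^k(Γ)`: locally, `η` is the restriction of a `C^k` function on an open subset
of `ℝ³`. -/
def IsCk (k : ℕ) (η : Γ → ℝ) : Prop :=
  ∀ y : Γ, ∃ F : E3 → ℝ, ContDiffAt ℝ k F (y : E3) ∧ ∀ᶠ x : Γ in 𝓝 y, F x = η x

/-- The tangent plane at `y`, as a linear subspace of `ℝ³`. -/
def tangentPlane (y : Γ) : Submodule ℝ E3 := (ℝ ∙ Γ.normal y)ᗮ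

/-- `X ∈ C^k(Γ, TΓ)`: a tangential vector field whose components are in `C^k(Γ)`. -/
structure IsTangentialCk (k : ℕ) (X : Γ → E3) : Prop where
  isCk : ∀ i, Γ.IsCk k (fun y => X y i)
  tangent : ∀ y, X y ∈ Γ.tangentPlane y

/-- The orthogonal projection matrix `P = I₃ - n ⊗ n` onto the tangent plane. -/
def P (y : Γ) : Matrix (Fin 3) (Fin 3) ℝ :=
  1 - Matrix.vecMulVec (Γ.normal y).ofLp (Γ.normal y).ofLp

open Classical in
/-- A `C¹` extension of `η` near `y` to a neighbourhood of `y` in `ℝ³`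
(zero if there is none). -/
def extension (η : Γ → ℝ) (y : Γ) : E3 → ℝ :=
  if h : ∃ F : E3 → ℝ, ContDiffAt ℝ 1 F (y : E3) ∧ ∀ᶠ x : Γ in 𝓝 y, F x = η x
  then h.choose else 0

/-- The tangential derivative `D_i η = ∑_j P_ij ∂_j η̃`, where `η̃` is a `C¹` extension
of `η`; for `η ∈ C¹(Γ)` it does not depend on the extension. -/
def tangDeriv (i : Fin 3) (η : Γ → ℝ) (y : Γ) : ℝ :=
  ∑ j, Γ.P y i j * fderiv ℝ (Γ.extension η y) (y : E3) (EuclideanSpace.single j 1)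

/-- The tangential gradient matrix `(∇_Γ X)_ij = D_i X_j`. -/
def gradMatrix (X : Γ → E3) (y : Γ) : Matrix (Fin 3) (Fin 3) ℝ :=
  Matrix.of fun i j => Γ.tangDeriv i (fun x => X x j) y

/-- The surface strain rate tensor `D_Γ(X) = P (∇_Γ X)_S P`. -/
def strainRate (X : Γ → E3) (y : Γ) : Matrix (Fin 3) (Fin 3) ℝ :=
  Γ.P y * ((1 / 2 : ℝ) • (Γ.gradMatrix X y + (Γ.gradMatrix X y)ᵀ)) * Γ.P y

/-- The surface divergence of a matrix field, `[div_Γ A]_j = ∑_i D_i A_ij`. -/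
def divMatrix (A : Γ → Matrix (Fin 3) (Fin 3) ℝ) (y : Γ) : E3 :=
  WithLp.toLp 2 fun j => ∑ i, Γ.tangDeriv i (fun x => A x i j) y

/-- The covariant derivative `v ↦ P (∇_Γ X)ᵀ v` of the tangential field `X` at `y`
in direction `v`. -/
def covDeriv (X : Γ → E3) (y : Γ) : E3 →ₗ[ℝ] E3 :=
  Matrix.toEuclideanLin (Γ.P y * (Γ.gradMatrix X y)ᵀ)

/-- A `(0,2)`-tensor field on the surface: a bilinear form on each tangent plane. -/
abbrev Tensor : Type := ∀ y : Γ, LinearMap.BilinForm ℝ (Γ.tangentPlane y)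

/-- `S ∈ C^k(Γ, T*Γ ⊗ T*Γ)`: `S(Y, Z) ∈ C^k(Γ)` for all `Y, Z ∈ C^k(Γ, TΓ)`. -/
def IsCkTensor (k : ℕ) (S : Γ.Tensor) : Prop :=
  ∀ (Y Z : Γ → E3) (hY : Γ.IsTangentialCk k Y) (hZ : Γ.IsTangentialCk k Z),
    Γ.IsCk k (fun y => S y ⟨Y y, hY.tangent y⟩ ⟨Z y, hZ.tangent y⟩)

/-- The inner product `∑_{i,j} S(τ_i, τ_j) T(τ_i, τ_j)` of bilinear forms on the tangent plane at
`y`, for an orthonormal basis `(τ_i)` of that plane (the value does not depend on the basis). -/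
def tensorInner (y : Γ) (S T : LinearMap.BilinForm ℝ (Γ.tangentPlane y)) : ℝ :=
  ∑ i, ∑ j,
    S (stdOrthonormalBasis ℝ (Γ.tangentPlane y) i) (stdOrthonormalBasis ℝ (Γ.tangentPlane y) j) *
    T (stdOrthonormalBasis ℝ (Γ.tangentPlane y) i) (stdOrthonormalBasis ℝ (Γ.tangentPlane y) j)

/-- The deformation tensor `(Def X)(v, w) = (∇̄_v X · w + v · ∇̄_w X) / 2`. -/
def defTensor (X : Γ → E3) : Γ.Tensor := fun y =>
  LinearMap.mk₂ ℝ
    (fun v w => (1 / 2 : ℝ) *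
      (inner ℝ (Γ.covDeriv X y v) (w : E3) + inner ℝ (v : E3) (Γ.covDeriv X y w)))
    (fun v v' w => by simp only [Submodule.coe_add, map_add, inner_add_left]; ring)
    (fun c v w => by
      simp only [Submodule.coe_smul, map_smul, real_inner_smul_left, smul_eq_mul]; ring)
    (fun v w w' => by simp only [Submodule.coe_add, map_add, inner_add_right]; ring)
    (fun c v w => by
      simp only [Submodule.coe_smul, map_smul, real_inner_smul_right, smul_eq_mul]; ring)

/-- `Z ∈ C(Γ, TΓ)` satisfies the defining property of `Def* S`:
`∫ θ(Z, Y) = ∫ θ(S, Def Y)` for all `Y ∈ C¹(Γ, TΓ)`. -/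
structure IsDefStar (S : Γ.Tensor) (Z : Γ → E3) : Prop where
  continuous : Continuous Z
  tangent : ∀ y, Z y ∈ Γ.tangentPlane y
  integral_eq : ∀ Y : Γ → E3, Γ.IsTangentialCk 1 Y →
    ∫ y, inner ℝ (Z y) (Y y) ∂Γ.area = ∫ y, Γ.tensorInner y (S y) (Γ.defTensor Y y) ∂Γ.area

open Classical in
/-- The formal adjoint `Def*` of the deformation operator (zero where it is undefined). -/
def defStar (S : Γ.Tensor) : Γ → E3 :=
  if h : ∃ Z, Γ.IsDefStar S Z then h.choose else 0

end ClosedSurface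

end

/-! Put `A = g D_Γ(X)`. This `C¹` matrix field is symmetric, satisfies `P A = A = A P` and
represents the bilinear form `g Def X` on tangent vectors. Hence, for tangential `Y`, `θ(g Def X,
Def Y)` is the Frobenius product of `A` and `∇_Γ Y` (`tensorInner_defTensor`), and the product rule
turns it into `div_Γ(A Y) - (div_Γ A) · Y`. The field `A Y` is tangential and `C¹`, so its
divergence integrates to zero over `Γ`, and tangency of `Y` allows `div_Γ A` to be replaced by `P
div_Γ A`. So `-P div_Γ A` has the defining property of the adjoint (`isDefStar_neg_divMatrix`), and
testing with localised tangential fields shows that nothing else has it (`IsDefStar.unique`).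

Most of the work is the divergence theorem for tangential fields
(`ClosedSurface.integral_div_eq_zero`), with area given by Hausdorff measure. A partition of unity
reduces it to fields supported in a piece of `Γ` that is a graph `x_k = h(x_{k+1}, x_{k+2})`. There
the area formula gives the density `s = √(1 + |∇h|²)`, and `s div_Γ W = ∂₀(s W_{k+1}) + ∂₁(s
W_{k+2})` (`graphDensity_mul_div`). The right side is a plane divergence of compactly supported `C¹`
functions, whose integral is zero. No curvature term appears because `W` is tangential. -/

noncomputable section

open Set Filter
open scoped NNReal ENNReal

/-! ### Area formula for Hausdorff measure -/

/-- If distances between values of `a` on `s` are at most `K` times those between values of `b`,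
then the Hausdorff measure of `a '' s` is at most `K ^ d` times that of `b '' s`. -/
theorem euclideanHausdorffMeasure_image_le_of_edist_le {α X Y : Type*}
    [MetricSpace X] [MeasurableSpace X] [BorelSpace X]
    [MetricSpace Y] [MeasurableSpace Y] [BorelSpace Y] {a : α → X} {b : α → Y} {s : Set α}
    {K : ℝ≥0} (d : ℕ)
    (h : ∀ x ∈ s, ∀ y ∈ s, edist (a x) (a y) ≤ K * edist (b x) (b y)) :
    μHE[d] (a '' s) ≤ (K : ℝ≥0∞) ^ d * μHE[d] (b '' s) := by
  rcases s.eq_empty_or_nonempty with rfl | ⟨x₀, hx₀⟩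
  · simp
  have : Nonempty α := ⟨x₀⟩
  have hinv : ∀ x ∈ s, Function.invFunOn b s (b x) ∈ s ∧ b (Function.invFunOn b s (b x)) = b x :=
    fun x hx => ⟨Function.invFunOn_mem ⟨x, hx, rfl⟩, Function.invFunOn_eq ⟨x, hx, rfl⟩⟩
  -- `b` need not be injective, but points of `s` with equal `b`-values have equal `a`-values, so
  -- `a` factors through `b` on `s`.
  have hval : ∀ x ∈ s, a (Function.invFunOn b s (b x)) = a x := fun x hx => by
    have := h _ (hinv x hx).1 x hx
    rw [(hinv x hx).2, edist_self, mul_zero] at this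
    exact edist_le_zero.1 this
  have himg : a '' s = (a ∘ Function.invFunOn b s) '' (b '' s) := by
    rw [image_image]
    exact image_congr fun x hx => (hval x hx).symm
  have hlip : LipschitzOnWith K (a ∘ Function.invFunOn b s) (b '' s) := by
    rintro _ ⟨x, hx, rfl⟩ _ ⟨y, hy, rfl⟩
    simp only [Function.comp_apply, hval x hx, hval y hy]
    exact h x hx y hy
  have := hlip.hausdorffMeasure_image_le (Nat.cast_nonneg (α := ℝ) d)
  rw [← himg, ENNReal.rpow_natCast] at this
  simp only [Measure.euclideanHausdorffMeasure_def, Measure.smul_apply, ENNReal.smul_def,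
    smul_eq_mul]
  calc _ ≤ _ := mul_le_mul_right this _
    _ = _ := by ring

/-- Inequalities between measures can be checked locally. -/
theorem MeasureTheory.Measure.le_of_locally_le {X : Type*} [TopologicalSpace X]
    [SecondCountableTopology X] [MeasurableSpace X] [OpensMeasurableSpace X] {μ ν : Measure X}
    {U : Set X} (hμ : μ Uᶜ = 0)
    (h : ∀ x ∈ U, ∃ N ∈ 𝓝 x, ∀ B ⊆ N, MeasurableSet B → μ B ≤ ν B) : μ ≤ ν := by
  choose! N hN hle using h
  obtain ⟨t, htU, htc, hcov⟩ := TopologicalSpace.countable_cover_nhdsWithin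
    (f := fun x => interior (N x)) (s := U)
    fun x hx => mem_nhdsWithin_of_mem_nhds (interior_mem_nhds.2 (hN x hx))
  have := htc.to_subtype
  refine Measure.le_intro fun B hB _ => ?_
  -- Enumerating `t` by `ℕ` requires it to be nonempty; if it is empty, so is `U`, and `μ` vanishes.
  rcases isEmpty_or_nonempty t with ht | ht
  · have : U = ∅ := by
      rw [eq_empty_iff_forall_notMem]
      intro x hx
      obtain ⟨i, hi, -⟩ := mem_iUnion₂.1 (hcov hx)
      exact ht.elim ⟨i, hi⟩
    rw [this, compl_empty] at hμ
    rw [measure_mono_null (subset_univ B) hμ]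
    exact zero_le
  obtain ⟨e, he⟩ := exists_surjective_nat t
  set V : ℕ → Set X := fun i => interior (N (e i))
  have hVm : ∀ i, MeasurableSet (disjointed V i) :=
    fun i => MeasurableSet.disjointed (fun j => isOpen_interior.measurableSet) i
  have hUV : U ⊆ ⋃ i, disjointed V i := by
    rw [iUnion_disjointed]
    intro x hx
    obtain ⟨i, hi, hxi⟩ := mem_iUnion₂.1 (hcov hx)
    obtain ⟨j, hj⟩ := he ⟨i, hi⟩
    exact mem_iUnion.2 ⟨j, by simpa [V, hj] using hxi⟩
  have hdis : Pairwise (Function.onFun Disjoint fun i => B ∩ disjointed V i) :=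
    fun i j hij => (disjoint_disjointed V hij).mono inter_subset_right inter_subset_right
  calc μ B ≤ μ ((⋃ i, B ∩ disjointed V i) ∪ Uᶜ) := measure_mono fun x hx => by
        by_cases hxU : x ∈ U
        · left
          rw [← inter_iUnion]
          exact ⟨hx, hUV hxU⟩
        · exact Or.inr hxU
    _ ≤ μ (⋃ i, B ∩ disjointed V i) + μ Uᶜ := measure_union_le _ _
    _ = ∑' i, μ (B ∩ disjointed V i) := by
        rw [hμ, add_zero, measure_iUnion hdis fun i => hB.inter (hVm i)]
    _ ≤ ∑' i, ν (B ∩ disjointed V i) := ENNReal.tsum_le_tsum fun i =>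
        hle _ (htU (e i).2) _ (inter_subset_right.trans
          ((disjointed_subset V i).trans interior_subset)) (hB.inter (hVm i))
    _ = ν (⋃ i, B ∩ disjointed V i) := by
        rw [measure_iUnion hdis fun i => hB.inter (hVm i)]
    _ ≤ ν B := measure_mono (iUnion_subset fun i => inter_subset_left)

/-- A map with injective strict derivative `L` distorts distances locally almost as `L` does. -/
theorem HasStrictFDerivAt.eventually_edist_comparable {E V : Type*} [NormedAddCommGroup E]
    [InnerProductSpace ℝ E] [FiniteDimensional ℝ E] [NormedAddCommGroup V] [InnerProductSpace ℝ V]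
    {f : E → V} {L : E →L[ℝ] V} {x : E}
    (hf : HasStrictFDerivAt f L x) (hL : Function.Injective L) {K : ℝ≥0} (hK : 1 < K) :
    ∃ N ∈ 𝓝 x, ∀ y ∈ N, ∀ z ∈ N, edist (f y) (f z) ≤ K * edist (L y) (L z) ∧
      edist (L y) (L z) ≤ K * edist (f y) (f z) := by
  have hK0 : (0 : ℝ) < K := lt_trans one_pos (by exact_mod_cast hK)
  have hK1 : (1 : ℝ) < K := by exact_mod_cast hK
  obtain ⟨C, hC0, hC⟩ := L.toLinearMap.exists_antilipschitzWith (LinearMap.ker_eq_bot.2 hL)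
  have hC0' : (0 : ℝ) < C := by exact_mod_cast hC0
  have hLC : ∀ v, ‖v‖ ≤ C * ‖L v‖ := fun v => by
    simpa using hC.le_mul_dist v 0
  -- Chosen so that `1 - δ = 1 / K` and `1 + δ ≤ K`: a relative error `δ` then costs at most a
  -- factor `K` in either direction.
  set δ : ℝ := (K - 1) / K with hδ
  have hδ0 : 0 < δ := div_pos (by linarith) hK0
  have hb := hf.isLittleO.def (div_pos hδ0 hC0')
  rw [nhds_prod_eq] at hb
  obtain ⟨N, hN, hb⟩ := mem_prod_self_iff.1 hb
  refine ⟨N, hN, fun y hy z hz => ?_⟩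
  have h1 : ‖f y - f z - L (y - z)‖ ≤ δ / C * ‖y - z‖ := hb (mk_mem_prod hy hz)
  have h2 : ‖f y - f z - L (y - z)‖ ≤ δ * ‖L (y - z)‖ := by
    refine h1.trans ?_
    have := mul_le_mul_of_nonneg_left (hLC (y - z)) (div_pos hδ0 hC0').le
    refine this.trans (le_of_eq ?_)
    field_simp
  have hKδ : K * δ = K - 1 := by rw [hδ]; field_simp
  have hL0 := norm_nonneg (L (y - z))
  have conv : ∀ (a b c d : V), ‖a - b‖ ≤ K * ‖c - d‖ → edist a b ≤ K * edist c d := by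
    intro a b c d h
    rw [edist_nndist, edist_nndist]
    have h' : nndist a b ≤ K * nndist c d := by
      rw [← NNReal.coe_le_coe]
      simpa [dist_eq_norm] using h
    exact_mod_cast h'
  constructor
  · apply conv
    rw [← map_sub]
    have : ‖f y - f z‖ ≤ ‖f y - f z - L (y - z)‖ + ‖L (y - z)‖ := by
      simpa using norm_add_le (f y - f z - L (y - z)) (L (y - z))
    have hδK : δ ≤ K - 1 := by nlinarith
    nlinarith
  · apply conv
    rw [← map_sub]
    have h3 : ‖L (y - z)‖ ≤ ‖f y - f z‖ + ‖f y - f z - L (y - z)‖ := by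
      have := norm_sub_le (f y - f z) (f y - f z - L (y - z))
      simpa using this
    have h4 : K * ‖L (y - z)‖ ≤ K * ‖f y - f z‖ + K * (δ * ‖L (y - z)‖) := by
      rw [← mul_add]
      exact mul_le_mul_of_nonneg_left (h3.trans (add_le_add_right h2 _)) hK0.le
    have h5 : K * (δ * ‖L (y - z)‖) = (K - 1) * ‖L (y - z)‖ := by rw [← mul_assoc, hKδ]
    linarith

section AreaFormula

variable {E V : Type*} [NormedAddCommGroup E] [InnerProductSpace ℝ E] [FiniteDimensional ℝ E]
  [MeasurableSpace E] [BorelSpace E] [NormedAddCommGroup V] [InnerProductSpace ℝ V]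
  [MeasurableSpace V] [BorelSpace V]

/-- The area formula for an embedding with a measurable left inverse. -/
theorem map_restrict_image_euclideanHausdorffMeasure {f : E → V} {f' : E → E →L[ℝ] V} {p : V → E}
    {U : Set E} (hU : IsOpen U) (hp : Measurable p) (hpf : ∀ x ∈ U, p (f x) = x)
    (hf : ∀ x ∈ U, HasStrictFDerivAt f (f' x) x) (hinj : ∀ x ∈ U, Function.Injective (f' x))
    (hJ : ContinuousOn (fun x => (f' x).toLinearMap.normDet) U) :
    ((μHE[Module.finrank ℝ E] : Measure V).restrict (f '' U)).map p =
      (volume.restrict U).withDensity fun x => ENNReal.ofReal (f' x).toLinearMap.normDet := by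
  set d := Module.finrank ℝ E
  set J : E → ℝ := fun x => (f' x).toLinearMap.normDet
  set ν := ((μHE[d] : Measure V).restrict (f '' U)).map p
  set m := (volume.restrict U).withDensity fun x => ENNReal.ofReal (J x)
  have hν : ∀ B, MeasurableSet B → ν B = μHE[d] (f '' (B ∩ U)) := fun B hB => by
    rw [Measure.map_apply hp hB, Measure.restrict_apply (hp hB)]
    congr 1
    ext v
    constructor
    · rintro ⟨hv, x, hx, rfl⟩
      rw [mem_preimage, hpf x hx] at hv
      exact ⟨x, ⟨hv, hx⟩, rfl⟩
    · rintro ⟨x, ⟨hxB, hx⟩, rfl⟩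
      exact ⟨by rwa [mem_preimage, hpf x hx], x, hx, rfl⟩
  have hm : ∀ B, MeasurableSet B → m B = ∫⁻ x in B ∩ U, ENNReal.ofReal (J x) := fun B hB => by
    rw [withDensity_apply _ hB, Measure.restrict_restrict hB]
  have hνU : ν Uᶜ = 0 := by
    rw [hν _ hU.measurableSet.compl]; simp
  have hmU : m Uᶜ = 0 := by
    rw [hm _ hU.measurableSet.compl]; simp
  have hJpos : ∀ x ∈ U, 0 < J x := fun x hx =>
    lt_of_le_of_ne (LinearMap.normDet_nonneg _)
      (Ne.symm (((f' x).toLinearMap.normDet_ne_zero_tfae.out 4 0).1 (hinj x hx)))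
  -- Near `x` compare both measures with that of the linear image `f' x '' (B ∩ U)`, whose volume is
  -- known exactly. Distortion of distances costs `K ^ d`, the oscillation of `J` one further factor
  -- `K`.
  have key : ∀ K : ℝ≥0, 1 < K → ∀ x ∈ U, ∃ N ∈ 𝓝 x, ∀ B ⊆ N, MeasurableSet B →
      ν B ≤ (K : ℝ≥0∞) ^ (d + 1) * m B ∧ m B ≤ (K : ℝ≥0∞) ^ (d + 1) * ν B := by
    intro K hK x hx
    have hK1 : (1 : ℝ) < K := by exact_mod_cast hK
    obtain ⟨N₁, hN₁, hb⟩ := (hf x hx).eventually_edist_comparable (hinj x hx) hK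
    have hJx := hJ.continuousAt (hU.mem_nhds hx)
    have hN₂ : ∀ᶠ y in 𝓝 x, J y < K * J x :=
      hJx.eventually_lt_const (by have := hJpos x hx; change J x < _; nlinarith)
    have hN₃ : ∀ᶠ y in 𝓝 x, J x < K * J y :=
      (hJx.const_mul (K : ℝ)).eventually_const_lt
        (by have := hJpos x hx; change _ < (K : ℝ) * J x; nlinarith)
    refine ⟨N₁ ∩ {y | J y < K * J x ∧ J x < K * J y}, inter_mem hN₁ (hN₂.and hN₃),
      fun B hBN hB => ?_⟩
    have hBU : MeasurableSet (B ∩ U) := hB.inter hU.measurableSet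
    have hL : μHE[d] (f' x '' (B ∩ U)) = ENNReal.ofReal (J x) * volume (B ∩ U) :=
      (f' x).toLinearMap.euclideanHausdorffMeasure_image_eq_normDet_mul_volume _
    have e1 : μHE[d] (f '' (B ∩ U)) ≤ (K : ℝ≥0∞) ^ d * μHE[d] (f' x '' (B ∩ U)) :=
      euclideanHausdorffMeasure_image_le_of_edist_le d fun y hy z hz =>
        (hb y (hBN hy.1).1 z (hBN hz.1).1).1
    have e2 : μHE[d] (f' x '' (B ∩ U)) ≤ (K : ℝ≥0∞) ^ d * μHE[d] (f '' (B ∩ U)) :=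
      euclideanHausdorffMeasure_image_le_of_edist_le d fun y hy z hz =>
        (hb y (hBN hy.1).1 z (hBN hz.1).1).2
    have hKJ : ∀ y, ENNReal.ofReal (K * J y) = K * ENNReal.ofReal (J y) := fun y => by
      rw [ENNReal.ofReal_mul K.coe_nonneg, ENNReal.ofReal_coe_nnreal]
    have e3 : ENNReal.ofReal (J x) * volume (B ∩ U) ≤ K * m B := by
      rw [hm B hB, ← lintegral_const_mul' _ _ ENNReal.coe_ne_top, ← setLIntegral_const]
      refine setLIntegral_mono' hBU fun y hy => ?_
      rw [← hKJ]
      exact ENNReal.ofReal_le_ofReal (hBN hy.1).2.2.le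
    have e4 : m B ≤ K * (ENNReal.ofReal (J x) * volume (B ∩ U)) := by
      rw [hm B hB, ← mul_assoc, ← hKJ, ← setLIntegral_const]
      exact setLIntegral_mono' hBU fun y hy => ENNReal.ofReal_le_ofReal (hBN hy.1).2.1.le
    rw [hν B hB]
    constructor
    · calc _ ≤ _ := e1
        _ ≤ (K : ℝ≥0∞) ^ d * (K * m B) := mul_le_mul_right (hL.trans_le e3) _
        _ = _ := by ring
    · calc _ ≤ _ := e4
        _ ≤ K * ((K : ℝ≥0∞) ^ d * μHE[d] (f '' (B ∩ U))) := mul_le_mul_right (hL ▸ e2) _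
        _ = _ := by ring
  -- Let `K` decrease to `1`.
  have lim : ∀ a b : ℝ≥0∞, (∀ K : ℝ≥0, 1 < K → a ≤ (K : ℝ≥0∞) ^ (d + 1) * b) → a ≤ b := by
    intro a b h
    have ht : Tendsto (fun K : ℝ≥0 => (K : ℝ≥0∞) ^ (d + 1) * b) (𝓝[>] 1) (𝓝 (1 * b)) := by
      refine ENNReal.Tendsto.mul_const ?_ (Or.inl one_ne_zero)
      have : Continuous fun K : ℝ≥0 => ((K ^ (d + 1) : ℝ≥0) : ℝ≥0∞) := by fun_prop
      have := (this.tendsto 1).mono_left (nhdsWithin_le_nhds (s := Ioi 1))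
      simpa using this
    rw [one_mul] at ht
    exact ge_of_tendsto ht (eventually_nhdsWithin_of_forall fun K hK => h K hK)
  refine le_antisymm ?_ ?_
  · refine Measure.le_intro fun B hB _ => lim _ _ fun K hK => ?_
    have : ν ≤ (K : ℝ≥0∞) ^ (d + 1) • m := Measure.le_of_locally_le hνU fun x hx => by
      obtain ⟨N, hN, h⟩ := key K hK x hx
      exact ⟨N, hN, fun B hB hBm => (h B hB hBm).1⟩
    simpa using this B
  · refine Measure.le_intro fun B hB _ => lim _ _ fun K hK => ?_
    have : m ≤ (K : ℝ≥0∞) ^ (d + 1) • ν := Measure.le_of_locally_le hmU fun x hx => by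
      obtain ⟨N, hN, h⟩ := key K hK x hx
      exact ⟨N, hN, fun B hB hBm => (h B hB hBm).2⟩
    simpa using this B

end AreaFormula

/-! ### Functions of class `C^k` on the surface and tangential derivatives -/

theorem E3.inner_eq_sum (x y : E3) : inner ℝ x y = ∑ i, x i * y i := by
  simp [PiLp.inner_apply, mul_comm]

theorem E3.eq_sum_single (v : E3) : v = ∑ i, v i • EuclideanSpace.single i (1 : ℝ) := by
  ext j
  fin_cases j <;> simp [Fin.sum_univ_three]

namespace ClosedSurface

variable {Γ : ClosedSurface}

theorem IsCk.of_contDiff {k : ℕ} {F : E3 → ℝ} (hF : ContDiff ℝ k F) :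
    Γ.IsCk k (fun y => F y) :=
  fun _ => ⟨F, hF.contDiffAt, Eventually.of_forall fun _ => rfl⟩

theorem IsCk.const {k : ℕ} (c : ℝ) : Γ.IsCk k (fun _ => c) :=
  IsCk.of_contDiff (F := fun _ => c) contDiff_const

theorem IsCk.add {k : ℕ} {η ζ : Γ → ℝ} (hη : Γ.IsCk k η) (hζ : Γ.IsCk k ζ) :
    Γ.IsCk k (fun y => η y + ζ y) := fun y => by
  obtain ⟨F, hF, hFη⟩ := hη y
  obtain ⟨G, hG, hGζ⟩ := hζ y
  refine ⟨fun x => F x + G x, hF.add hG, ?_⟩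
  filter_upwards [hFη, hGζ] with x h1 h2
  rw [h1, h2]

theorem IsCk.mul {k : ℕ} {η ζ : Γ → ℝ} (hη : Γ.IsCk k η) (hζ : Γ.IsCk k ζ) :
    Γ.IsCk k (fun y => η y * ζ y) := fun y => by
  obtain ⟨F, hF, hFη⟩ := hη y
  obtain ⟨G, hG, hGζ⟩ := hζ y
  refine ⟨fun x => F x * G x, hF.mul hG, ?_⟩
  filter_upwards [hFη, hGζ] with x h1 h2
  rw [h1, h2]

theorem IsCk.neg {k : ℕ} {η : Γ → ℝ} (hη : Γ.IsCk k η) : Γ.IsCk k (fun y => -η y) := by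
  simpa using (IsCk.const (Γ := Γ) (-1)).mul hη

theorem IsCk.sum {ι : Type*} {k : ℕ} {s : Finset ι} {η : ι → Γ → ℝ}
    (hη : ∀ i ∈ s, Γ.IsCk k (η i)) : Γ.IsCk k (fun y => ∑ i ∈ s, η i y) := by
  classical
  induction s using Finset.induction_on with
  | empty => simpa using IsCk.const (Γ := Γ) 0
  | insert a s ha ih =>
    simp only [Finset.sum_insert ha]
    exact (hη a (Finset.mem_insert_self a s)).add
      (ih fun i hi => hη i (Finset.mem_insert_of_mem hi))

theorem IsCk.mono {k l : ℕ} (hkl : k ≤ l) {η : Γ → ℝ} (hη : Γ.IsCk l η) : Γ.IsCk k η := fun y => by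
  obtain ⟨F, hF, hFη⟩ := hη y
  exact ⟨F, hF.of_le (by exact_mod_cast hkl), hFη⟩

theorem IsCk.continuous {k : ℕ} {η : Γ → ℝ} (hη : Γ.IsCk k η) : Continuous η := by
  refine continuous_iff_continuousAt.2 fun y => ?_
  obtain ⟨F, hF, hFη⟩ := hη y
  have : ContinuousAt (fun x : Γ => F x) y :=
    ContinuousAt.comp (f := ((↑) : Γ → E3)) hF.continuousAt continuous_subtype_val.continuousAt
  exact this.congr hFη

variable (Γ) in
/-- A local equation of the surface near one of its points. -/
theorem exists_equation (y : Γ) : ∃ f : E3 → ℝ, ContDiffAt ℝ 3 f y ∧ ∇ f y ≠ 0 ∧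
    (∀ᶠ x : E3 in 𝓝 y, x ∈ Γ.carrier ↔ f x = 0) ∧
    ∀ᶠ x : Γ in 𝓝 y, ∇ f x ≠ 0 ∧ Γ.normal x = ‖∇ f x‖⁻¹ • ∇ f x := by
  obtain ⟨V, f, hV, hy, hf, hne, hiff, hn⟩ := Γ.exists_local_equation y
  refine ⟨f, hf.contDiffAt (hV.mem_nhds hy), hne _ hy, ?_, ?_⟩
  · filter_upwards [hV.mem_nhds hy] with x hx using hiff x hx
  · have : ∀ᶠ x : Γ in 𝓝 y, (x : E3) ∈ V :=
      continuous_subtype_val.continuousAt.eventually (hV.mem_nhds hy)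
    filter_upwards [this] with x hx using ⟨hne _ hx, hn x hx⟩

variable (Γ) in
theorem norm_normal (y : Γ) : ‖Γ.normal y‖ = 1 := by
  obtain ⟨f, -, hne, -, hn⟩ := Γ.exists_equation y
  rw [hn.self_of_nhds.2, norm_smul, norm_inv, norm_norm, inv_mul_cancel₀ (norm_ne_zero_iff.2 hne)]

variable (Γ) in
theorem sum_normal_mul_normal (y : Γ) : ∑ i, Γ.normal y i * Γ.normal y i = 1 := by
  rw [← E3.inner_eq_sum, real_inner_self_eq_norm_sq, norm_normal, one_pow]

/-- The gradient of the `C³` local equation is `C²` and nonzero, so normalising it keeps the class.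
-/
theorem isCk_normal (i : Fin 3) : Γ.IsCk 2 (fun y => Γ.normal y i) := fun y => by
  obtain ⟨f, hf, hne, -, hn⟩ := Γ.exists_equation y
  have hgrad : ContDiffAt ℝ 2 (fun x => ∇ f x) (y : E3) :=
    ((InnerProductSpace.toDual ℝ E3).symm.contDiff.contDiffAt).comp (y : E3)
      (hf.fderiv_right (m := 2) (by norm_num))
  refine ⟨fun x => (‖∇ f x‖⁻¹ • ∇ f x) i, ?_, ?_⟩
  · have h1 : ContDiffAt ℝ 2 (fun x => ‖∇ f x‖⁻¹ • ∇ f x) (y : E3) :=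
      ((hgrad.norm ℝ hne).inv (norm_ne_zero_iff.2 hne)).smul hgrad
    exact contDiffAt_euclidean.1 h1 i
  · filter_upwards [hn] with x hx
    rw [hx.2]

variable (Γ) in
theorem P_apply (y : Γ) (i j : Fin 3) :
    Γ.P y i j = (if i = j then 1 else 0) - Γ.normal y i * Γ.normal y j := by
  simp [P, Matrix.one_apply, Matrix.vecMulVec_apply]

theorem isCk_P (i j : Fin 3) : Γ.IsCk 2 (fun y => Γ.P y i j) := by
  simp only [P_apply, sub_eq_add_neg]
  exact (IsCk.const _).add ((isCk_normal i).mul (isCk_normal j)).neg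

variable (Γ) in
theorem mem_tangentPlane_iff {y : Γ} {v : E3} :
    v ∈ Γ.tangentPlane y ↔ ∑ i, Γ.normal y i * v i = 0 := by
  rw [tangentPlane, Submodule.mem_orthogonal_singleton_iff_inner_right, E3.inner_eq_sum]

variable (Γ) in
theorem P_symm (y : Γ) (i j : Fin 3) : Γ.P y i j = Γ.P y j i := by
  simp only [P_apply, eq_comm (a := i), mul_comm]

variable (Γ) in
theorem sum_P_mul (y : Γ) (i : Fin 3) (v : Fin 3 → ℝ) :
    ∑ j, Γ.P y i j * v j = v i - Γ.normal y i * ∑ j, Γ.normal y j * v j := by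
  simp [P_apply, sub_mul, Finset.sum_sub_distrib, Finset.mul_sum, mul_assoc]

variable (Γ) in
theorem sum_P_mul_normal (y : Γ) (i : Fin 3) : ∑ j, Γ.P y i j * Γ.normal y j = 0 := by
  rw [sum_P_mul, sum_normal_mul_normal, mul_one, sub_self]

theorem sum_P_mul_of_mem {y : Γ} {v : E3} (hv : v ∈ Γ.tangentPlane y) (i : Fin 3) :
    ∑ j, Γ.P y i j * v j = v i := by
  rw [sum_P_mul, (Γ.mem_tangentPlane_iff).1 hv, mul_zero, sub_zero]

/-- A function vanishing on the surface has its gradient normal to the surface. -/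
theorem exists_fderiv_eq_of_eventually_eq_zero {y : Γ} {F : E3 → ℝ} (hF : ContDiffAt ℝ 1 F (y : E3))
    (h0 : ∀ᶠ x : Γ in 𝓝 y, F x = 0) :
    ∃ c : ℝ, ∀ v : E3, fderiv ℝ F (y : E3) v = c * inner ℝ (Γ.normal y) v := by
  obtain ⟨f, hf, hne, hiff, hn⟩ := Γ.exists_equation y
  have hfy : f y = 0 := hiff.self_of_nhds.1 y.2
  have hloc : ∀ᶠ x in 𝓝[{x | f x = f y}] (y : E3), F x = 0 := by
    rw [nhds_subtype_eq_comap, eventually_comap] at h0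
    rw [eventually_nhdsWithin_iff]
    filter_upwards [h0, hiff] with x hx hx' hfx
    exact hx ⟨x, hx'.2 (hfx.trans hfy)⟩ rfl
  have hFy : F y = 0 := h0.self_of_nhds
  -- `F` is constant on the level set of `f` near `y`, so `y` is trivially a constrained extremum
  -- and Lagrange multipliers apply.
  have hext : IsLocalExtrOn F {x | f x = f y} (y : E3) := by
    left
    filter_upwards [hloc] with x hx
    rw [hx, hFy]
  have hf' := hf.hasStrictFDerivAt (by norm_num)
  obtain ⟨a, b, hab, h⟩ := hext.exists_multipliers_of_hasStrictFDerivAt_1d hf'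
    (hF.hasStrictFDerivAt (by norm_num))
  have hgrad : ∀ v, fderiv ℝ f (y : E3) v = inner ℝ (∇ f (y : E3)) v := fun v => by
    simp [gradient]
  -- With `b = 0` the multiplier relation would force the gradient of `f` at `y` to vanish.
  have hb : b ≠ 0 := by
    rintro rfl
    have ha : a ≠ 0 := by rintro rfl; exact hab rfl
    apply hne
    have h1 := congrArg (fun L : E3 →L[ℝ] ℝ => L (∇ f (y : E3))) h
    simp only [zero_smul, add_zero, smul_apply, hgrad, smul_eq_mul,
      zero_apply, mul_eq_zero, ha, false_or, inner_self_eq_zero] at h1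
    exact h1
  refine ⟨-(a / b) * ‖∇ f (y : E3)‖, fun v => ?_⟩
  have h1 := congrArg (fun L : E3 →L[ℝ] ℝ => L v) h
  simp only [add_apply, smul_apply, hgrad, smul_eq_mul,
      zero_apply] at h1
  rw [hn.self_of_nhds.2, real_inner_smul_left]
  have : ‖∇ f (y : E3)‖ ≠ 0 := norm_ne_zero_iff.2 hne
  field_simp
  linarith

/-- The tangential derivative can be computed with any extension. -/
theorem tangDeriv_eq {y : Γ} {η : Γ → ℝ} {F : E3 → ℝ} (hF : ContDiffAt ℝ 1 F (y : E3))
    (h : ∀ᶠ x : Γ in 𝓝 y, F x = η x) (i : Fin 3) :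
    Γ.tangDeriv i η y =
      ∑ j, Γ.P y i j * fderiv ℝ F (y : E3) (EuclideanSpace.single j 1) := by
  have hex : ∃ F : E3 → ℝ, ContDiffAt ℝ 1 F (y : E3) ∧ ∀ᶠ x : Γ in 𝓝 y, F x = η x := ⟨F, hF, h⟩
  have hG : Γ.extension η y = hex.choose := dif_pos hex
  obtain ⟨hG1, hG2⟩ := hex.choose_spec
  rw [← hG] at hG1 hG2
  -- Two extensions differ by a function vanishing on `Γ`; its gradient is normal and is killed by
  -- `P`.
  obtain ⟨c, hc⟩ := exists_fderiv_eq_of_eventually_eq_zero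
    (F := fun x => Γ.extension η y x - F x) (hG1.sub hF) (by
      filter_upwards [h, hG2] with x h1 h2
      rw [h1, h2, sub_self])
  have hc' : ∀ j, fderiv ℝ (Γ.extension η y) (y : E3) (EuclideanSpace.single j 1) =
      fderiv ℝ F (y : E3) (EuclideanSpace.single j 1) + c * Γ.normal y j := fun j => by
    have := hc (EuclideanSpace.single j 1)
    rw [fderiv_fun_sub (hG1.differentiableAt (by norm_num)) (hF.differentiableAt (by norm_num))]
      at this
    simp only [sub_apply, EuclideanSpace.inner_single_right, one_mul,
      conj_trivial] at this
    linarith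
  simp only [tangDeriv, hc', mul_add, Finset.sum_add_distrib]
  have := Γ.sum_P_mul_normal y i
  have h2 : ∑ j, Γ.P y i j * (c * Γ.normal y j) = c * ∑ j, Γ.P y i j * Γ.normal y j := by
    rw [Finset.mul_sum]
    exact Finset.sum_congr rfl fun j _ => by ring
  rw [h2, this, mul_zero, add_zero]

/-- `extension` chooses an extension at each point separately, but by `tangDeriv_eq` a single `F`
computes the derivative at all nearby points. The bound `k ≤ 2` is the regularity of `P`. -/
theorem IsCk.tangDeriv {k : ℕ} (hk : k ≤ 2) {η : Γ → ℝ} (hη : Γ.IsCk (k + 1) η) (i : Fin 3) :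
    Γ.IsCk k (Γ.tangDeriv i η) := fun y => by
  obtain ⟨F, hF, hFη⟩ := hη y
  have hF' : ContDiffAt ℝ k (fderiv ℝ F) (y : E3) := hF.fderiv_right (by norm_cast)
  have key : ∀ᶠ x : Γ in 𝓝 y, Γ.tangDeriv i η x =
      ∑ j, Γ.P x i j * fderiv ℝ F (x : E3) (EuclideanSpace.single j 1) := by
    have h1 : ∀ᶠ x : Γ in 𝓝 y, ContDiffAt ℝ 1 F (x : E3) :=
      continuous_subtype_val.continuousAt.eventually
        ((hF.eventually (by simp)).mono fun x hx => hx.of_le (by norm_cast; omega))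
    filter_upwards [h1, hFη.eventually_nhds] with x hx1 hx2
    exact tangDeriv_eq hx1 hx2 i
  choose G hG hGP using fun j => (isCk_P (Γ := Γ) i j).mono hk y
  refine ⟨fun x => ∑ j, G j x * fderiv ℝ F x (EuclideanSpace.single j 1), ?_, ?_⟩
  · exact ContDiffAt.sum fun j _ => (hG j).mul (hF'.clm_apply contDiffAt_const)
  · filter_upwards [key, eventually_all.2 hGP] with x h1 h2
    rw [h1]
    simp only [h2]

theorem tangDeriv_add {η ζ : Γ → ℝ} (hη : Γ.IsCk 1 η) (hζ : Γ.IsCk 1 ζ) (i : Fin 3) (y : Γ) :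
    Γ.tangDeriv i (fun x => η x + ζ x) y = Γ.tangDeriv i η y + Γ.tangDeriv i ζ y := by
  obtain ⟨F, hF, hFη⟩ := hη y
  obtain ⟨G, hG, hGζ⟩ := hζ y
  rw [tangDeriv_eq hF hFη, tangDeriv_eq hG hGζ,
    tangDeriv_eq (F := fun x => F x + G x) (hF.add hG) (by
      filter_upwards [hFη, hGζ] with x h1 h2
      rw [h1, h2]),
    fderiv_fun_add (hF.differentiableAt (by norm_num)) (hG.differentiableAt (by norm_num)),
    ← Finset.sum_add_distrib]
  simp only [add_apply, mul_add]

theorem tangDeriv_mul {η ζ : Γ → ℝ} (hη : Γ.IsCk 1 η) (hζ : Γ.IsCk 1 ζ) (i : Fin 3) (y : Γ) :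
    Γ.tangDeriv i (fun x => η x * ζ x) y =
      η y * Γ.tangDeriv i ζ y + ζ y * Γ.tangDeriv i η y := by
  obtain ⟨F, hF, hFη⟩ := hη y
  obtain ⟨G, hG, hGζ⟩ := hζ y
  rw [tangDeriv_eq hF hFη, tangDeriv_eq hG hGζ,
    tangDeriv_eq (F := fun x => F x * G x) (hF.mul hG) (by
      filter_upwards [hFη, hGζ] with x h1 h2
      rw [h1, h2]),
    fderiv_fun_mul (hF.differentiableAt (by norm_num)) (hG.differentiableAt (by norm_num)),
    hFη.self_of_nhds, hGζ.self_of_nhds, Finset.mul_sum, Finset.mul_sum, ← Finset.sum_add_distrib]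
  refine Finset.sum_congr rfl fun j _ => ?_
  simp only [add_apply, smul_apply, smul_eq_mul]
  ring

theorem tangDeriv_const (c : ℝ) (i : Fin 3) (y : Γ) : Γ.tangDeriv i (fun _ => c) y = 0 := by
  rw [tangDeriv_eq (F := fun _ => c) contDiffAt_const (Eventually.of_forall fun _ => rfl)]
  simp

theorem tangDeriv_sum {ι : Type*} {s : Finset ι} {η : ι → Γ → ℝ} (hη : ∀ a ∈ s, Γ.IsCk 1 (η a))
    (i : Fin 3) (y : Γ) :
    Γ.tangDeriv i (fun x => ∑ a ∈ s, η a x) y = ∑ a ∈ s, Γ.tangDeriv i (η a) y := by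
  classical
  induction s using Finset.induction_on with
  | empty => simpa using tangDeriv_const (Γ := Γ) 0 i y
  | insert a s ha ih =>
    have hs : ∀ b ∈ s, Γ.IsCk 1 (η b) := fun b hb => hη b (Finset.mem_insert_of_mem hb)
    simp only [Finset.sum_insert ha]
    rw [tangDeriv_add (hη a (Finset.mem_insert_self a s)) (IsCk.sum hs), ih hs]

/-- The differential of a map into the surface takes values in the tangent plane. -/
theorem inner_normal_fderiv_eq_zero {E : Type*} [NormedAddCommGroup E] [NormedSpace ℝ E]
    {φ : E → E3} {u : E} {y : Γ} (hφ : DifferentiableAt ℝ φ u) (hy : φ u = y)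
    (hΓ : ∀ᶠ u' in 𝓝 u, φ u' ∈ Γ.carrier) (v : E) :
    inner ℝ (Γ.normal y) (fderiv ℝ φ u v) = 0 := by
  obtain ⟨f, hf, hne, hiff, hn⟩ := Γ.exists_equation y
  have hfd : DifferentiableAt ℝ f (φ u) := hy ▸ hf.differentiableAt (by norm_num)
  have h0 : f ∘ φ =ᶠ[𝓝 u] fun _ => 0 := by
    rw [← hy] at hiff
    filter_upwards [hΓ, hφ.continuousAt.eventually hiff] with u' h1 h2
    exact h2.1 h1
  have h1 := h0.fderiv_eq (𝕜 := ℝ)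
  rw [fderiv_comp u hfd hφ, fderiv_fun_const] at h1
  have h2 := congrArg (fun L : E →L[ℝ] ℝ => L v) h1
  have hgrad : ∀ v : E3, fderiv ℝ f (y : E3) v = inner ℝ (∇ f (y : E3)) v := fun v => by
    simp [gradient]
  simp only [ContinuousLinearMap.comp_apply, hy, hgrad, Pi.zero_apply,
    zero_apply] at h2
  rw [hn.self_of_nhds.2, real_inner_smul_left, h2, mul_zero]

end ClosedSurface

/-! ### Linear algebra of the strain rate and the deformation tensor -/

namespace ClosedSurface

variable {Γ : ClosedSurface}

variable (Γ) in
theorem P_transpose (y : Γ) : (Γ.P y)ᵀ = Γ.P y := by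
  ext i j
  exact Γ.P_symm y j i

variable (Γ) in
theorem P_mul_P (y : Γ) : Γ.P y * Γ.P y = Γ.P y := by
  ext i j
  rw [Matrix.mul_apply, sum_P_mul Γ y i fun k => Γ.P y k j]
  have : ∑ k, Γ.normal y k * Γ.P y k j = 0 := by
    rw [← Γ.sum_P_mul_normal y j]
    exact Finset.sum_congr rfl fun k _ => by rw [Γ.P_symm y k j, mul_comm]
  rw [this, mul_zero, sub_zero]

theorem P_mulVec {y : Γ} {v : E3} (hv : v ∈ Γ.tangentPlane y) :
    Γ.P y *ᵥ v.ofLp = v.ofLp := by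
  ext i
  exact sum_P_mul_of_mem hv i

variable (Γ) in
theorem toEuclideanLin_P_mem (y : Γ) (v : E3) :
    Matrix.toEuclideanLin (Γ.P y) v ∈ Γ.tangentPlane y := by
  rw [mem_tangentPlane_iff]
  change Γ.normal y ⬝ᵥ (Γ.P y *ᵥ v) = 0
  rw [Matrix.dotProduct_mulVec, ← Matrix.mulVec_transpose, P_transpose]
  have : Γ.P y *ᵥ (Γ.normal y).ofLp = 0 := by
    ext i
    exact Γ.sum_P_mul_normal y i
  rw [this, zero_dotProduct]

variable (Γ) in
theorem inner_toEuclideanLin_P (y : Γ) (v : E3) {w : E3} (hw : w ∈ Γ.tangentPlane y) :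
    inner ℝ (Matrix.toEuclideanLin (Γ.P y) v) w = inner ℝ v w := by
  rw [E3.inner_eq_sum, E3.inner_eq_sum]
  change (Γ.P y *ᵥ v) ⬝ᵥ w = v ⬝ᵥ w
  rw [dotProduct_comm, Matrix.dotProduct_mulVec, ← Matrix.mulVec_transpose, P_transpose,
    P_mulVec hw, dotProduct_comm]

theorem P_mul_strainRate (X : Γ → E3) (y : Γ) :
    Γ.P y * Γ.strainRate X y = Γ.strainRate X y := by
  rw [strainRate, ← Matrix.mul_assoc, ← Matrix.mul_assoc, P_mul_P]

theorem strainRate_mul_P (X : Γ → E3) (y : Γ) :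
    Γ.strainRate X y * Γ.P y = Γ.strainRate X y := by
  rw [strainRate, Matrix.mul_assoc, P_mul_P]

theorem strainRate_transpose (X : Γ → E3) (y : Γ) :
    (Γ.strainRate X y)ᵀ = Γ.strainRate X y := by
  simp only [strainRate, Matrix.transpose_mul, Matrix.transpose_smul, Matrix.transpose_add,
    Matrix.transpose_transpose, P_transpose, Matrix.mul_assoc]
  rw [add_comm]

/-- The deformation tensor is represented by the symmetrised tangential gradient. -/
theorem defTensor_apply (X : Γ → E3) (y : Γ) (v w : Γ.tangentPlane y) :
    Γ.defTensor X y v w = (v : E3).ofLp ⬝ᵥ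
      (((1 / 2 : ℝ) • (Γ.gradMatrix X y + (Γ.gradMatrix X y)ᵀ)) *ᵥ (w : E3).ofLp) := by
  have key : ∀ v w : Γ.tangentPlane y, inner ℝ (Γ.covDeriv X y v) (w : E3) =
      (v : E3).ofLp ⬝ᵥ (Γ.gradMatrix X y *ᵥ (w : E3).ofLp) := fun v w => by
    rw [E3.inner_eq_sum]
    change ((Γ.P y * (Γ.gradMatrix X y)ᵀ) *ᵥ (v : E3).ofLp) ⬝ᵥ (w : E3).ofLp = _
    rw [dotProduct_comm, Matrix.dotProduct_mulVec, ← Matrix.mulVec_transpose,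
      Matrix.transpose_mul, P_transpose, Matrix.transpose_transpose, ← Matrix.mulVec_mulVec,
      P_mulVec w.2, dotProduct_comm]
  change (1 / 2 : ℝ) * (inner ℝ (Γ.covDeriv X y v) (w : E3) + inner ℝ (v : E3) (Γ.covDeriv X y w))
    = _
  have h1 : inner ℝ (v : E3) (Γ.covDeriv X y w) = inner ℝ (Γ.covDeriv X y w) (v : E3) :=
    real_inner_comm _ _
  have h2 : (v : E3).ofLp ⬝ᵥ ((Γ.gradMatrix X y)ᵀ *ᵥ (w : E3).ofLp) =
      (w : E3).ofLp ⬝ᵥ (Γ.gradMatrix X y *ᵥ (v : E3).ofLp) := by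
    rw [Matrix.mulVec_transpose, dotProduct_comm, ← Matrix.dotProduct_mulVec]
  rw [h1, key, key, Matrix.smul_mulVec, Matrix.add_mulVec, dotProduct_smul, dotProduct_add,
    smul_eq_mul, h2]

/-- The outer projections in the strain rate act as the identity on tangent vectors. -/
theorem defTensor_apply_eq_strainRate (X : Γ → E3) (y : Γ) (v w : Γ.tangentPlane y) :
    Γ.defTensor X y v w = (v : E3).ofLp ⬝ᵥ (Γ.strainRate X y *ᵥ (w : E3).ofLp) := by
  rw [defTensor_apply, strainRate, ← Matrix.mulVec_mulVec, ← Matrix.mulVec_mulVec, P_mulVec w.2,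
    Matrix.dotProduct_mulVec _ (Γ.P y), ← Matrix.mulVec_transpose, P_transpose, P_mulVec v.2]

variable (Γ) in
/-- Completeness of an orthonormal basis of the tangent plane. -/
theorem sum_orthonormalBasis_mul {ι : Type*} [Fintype ι] (y : Γ)
    (τ : OrthonormalBasis ι ℝ (Γ.tangentPlane y)) (i j : Fin 3) :
    ∑ a, (τ a : E3) i * (τ a : E3) j = Γ.P y i j := by
  have h := τ.sum_repr' ⟨_, Γ.toEuclideanLin_P_mem y (EuclideanSpace.single j 1)⟩
  have h1 := congrArg (fun v : Γ.tangentPlane y => (v : E3) i) h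
  have h2 : (Matrix.toEuclideanLin (Γ.P y) (EuclideanSpace.single j 1)) i = Γ.P y i j := by
    change (Γ.P y *ᵥ (EuclideanSpace.single j (1 : ℝ)).ofLp) i = _
    simp
  simp only [h2] at h1
  rw [← h1]
  simp only [Submodule.coe_sum, Submodule.coe_smul, Submodule.coe_inner, WithLp.ofLp_sum,
    Finset.sum_apply, PiLp.smul_apply, smul_eq_mul]
  refine Finset.sum_congr rfl fun a _ => ?_
  rw [real_inner_comm, inner_toEuclideanLin_P Γ y _ (τ a).2, real_inner_comm,
    EuclideanSpace.inner_single_right]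
  simp [mul_comm]

/-- If the rows of `R` are an orthonormal basis of the tangent plane, then `Rᵀ R = P`. The double
sum is the trace of `(R A Rᵀ)(R B Rᵀ)ᵀ`, and cyclicity removes the basis. -/
theorem tensorInner_eq_trace {y : Γ} {S T : LinearMap.BilinForm ℝ (Γ.tangentPlane y)}
    {A B : Matrix (Fin 3) (Fin 3) ℝ} (hS : ∀ v w, S v w = (v : E3).ofLp ⬝ᵥ (A *ᵥ (w : E3).ofLp))
    (hT : ∀ v w, T v w = (v : E3).ofLp ⬝ᵥ (B *ᵥ (w : E3).ofLp)) :
    Γ.tensorInner y S T = (Γ.P y * A * Γ.P y * Bᵀ).trace := by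
  set τ := stdOrthonormalBasis ℝ (Γ.tangentPlane y)
  set R : Matrix (Fin (Module.finrank ℝ (Γ.tangentPlane y))) (Fin 3) ℝ :=
    Matrix.of fun a i => (τ a : E3) i
  have hR : Rᵀ * R = Γ.P y := by
    ext i j
    rw [← Γ.sum_orthonormalBasis_mul y τ i j]
    rfl
  have hent : ∀ (M : Matrix (Fin 3) (Fin 3) ℝ) a b,
      (τ a : E3).ofLp ⬝ᵥ (M *ᵥ (τ b : E3).ofLp) = (R * M * Rᵀ) a b := fun M a b => by
    rw [Matrix.mul_assoc]
    rfl
  have h1 : Γ.tensorInner y S T = ((R * A * Rᵀ) * (R * B * Rᵀ)ᵀ).trace := by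
    simp only [tensorInner, hS, hT]
    refine Finset.sum_congr rfl fun a _ => ?_
    rw [Matrix.diag_apply, Matrix.mul_apply]
    refine Finset.sum_congr rfl fun b _ => ?_
    rw [hent, hent, Matrix.transpose_apply]
  rw [h1, Matrix.transpose_mul, Matrix.transpose_mul, Matrix.transpose_transpose, ← hR,
    ← Matrix.mul_assoc R Bᵀ, ← Matrix.mul_assoc, Matrix.trace_mul_comm]
  simp only [Matrix.mul_assoc]

/-- The inner product of `g Def X` and `Def Y` is the Frobenius product of `g D(X)` and the
tangential gradient of `Y`. -/
theorem tensorInner_defTensor (c : ℝ) (X Y : Γ → E3) (y : Γ) :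
    Γ.tensorInner y (c • Γ.defTensor X y) (Γ.defTensor Y y) =
      ∑ i, ∑ j, (c • Γ.strainRate X y) i j * Γ.gradMatrix Y y i j := by
  -- Only `Def X` is represented with projections. Those coming from the trace formula are absorbed
  -- by the strain rate, which leaves the bare gradient of `Y`.
  rw [tensorInner_eq_trace (A := c • Γ.strainRate X y) (fun v w => by
    rw [LinearMap.smul_apply, LinearMap.smul_apply, defTensor_apply_eq_strainRate,
      Matrix.smul_mulVec, dotProduct_smul]) (defTensor_apply Y y),
    Matrix.mul_smul, P_mul_strainRate, Matrix.smul_mul, strainRate_mul_P]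
  have hsymm : ∀ M : Matrix (Fin 3) (Fin 3) ℝ,
      ∑ i, ∑ j, (c • Γ.strainRate X y) i j * M i j = (c • Γ.strainRate X y * Mᵀ).trace := by
    intro M
    simp [Matrix.trace, Matrix.mul_apply, Finset.mul_sum, mul_assoc]
  -- A symmetric matrix pairs equally with a matrix and with its transpose.
  have ht : (c • Γ.strainRate X y * Γ.gradMatrix Y y).trace =
      (c • Γ.strainRate X y * (Γ.gradMatrix Y y)ᵀ).trace := by
    rw [← Matrix.trace_transpose, Matrix.transpose_mul, Matrix.transpose_smul,
      strainRate_transpose, Matrix.trace_mul_comm]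
  rw [hsymm, Matrix.transpose_smul, Matrix.transpose_add, Matrix.transpose_transpose,
    Matrix.mul_smul, Matrix.mul_add, Matrix.trace_smul, Matrix.trace_add, ht, smul_eq_mul]
  ring

end ClosedSurface

/-! ### Graphs over coordinate planes -/

/-- The Euclidean plane. -/
abbrev E2 : Type := EuclideanSpace ℝ (Fin 2)

namespace E3

/-- The sum over the three coordinates, starting at the coordinate `k`. -/
theorem sum_eq_cyclic {M : Type*} [AddCommMonoid M] (k : Fin 3) (F : Fin 3 → M) :
    ∑ i, F i = F k + F (k + 1) + F (k + 2) := by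
  rw [← Equiv.sum_comp (Equiv.addLeft k) F, Fin.sum_univ_three]
  simp

/-- The projection onto the coordinate plane orthogonal to the `k`-th axis. -/
def planeProj (k : Fin 3) : E3 →L[ℝ] E2 :=
  (EuclideanSpace.proj (k + 1)).smulRight (EuclideanSpace.single 0 1) +
    (EuclideanSpace.proj (k + 2)).smulRight (EuclideanSpace.single 1 1)

/-- The inclusion of the coordinate plane orthogonal to the `k`-th axis. -/
def planeIncl (k : Fin 3) : E2 →L[ℝ] E3 :=
  (EuclideanSpace.proj 0).smulRight (EuclideanSpace.single (k + 1) 1) +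
    (EuclideanSpace.proj 1).smulRight (EuclideanSpace.single (k + 2) 1)

@[simp] theorem planeProj_apply_zero (k : Fin 3) (x : E3) : planeProj k x 0 = x (k + 1) := by
  simp [planeProj]

@[simp] theorem planeProj_apply_one (k : Fin 3) (x : E3) : planeProj k x 1 = x (k + 2) := by
  simp [planeProj]

theorem planeIncl_apply (k : Fin 3) (u : E2) : planeIncl k u =
    u 0 • EuclideanSpace.single (k + 1) 1 + u 1 • EuclideanSpace.single (k + 2) 1 := by
  simp [planeIncl]

@[simp] theorem planeIncl_apply_self (k : Fin 3) (u : E2) : planeIncl k u k = 0 := by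
  fin_cases k <;> simp [planeIncl]

@[simp] theorem planeIncl_apply_add_one (k : Fin 3) (u : E2) :
    planeIncl k u (k + 1) = u 0 := by
  fin_cases k <;> simp [planeIncl]

@[simp] theorem planeIncl_apply_add_two (k : Fin 3) (u : E2) :
    planeIncl k u (k + 2) = u 1 := by
  fin_cases k <;> simp [planeIncl]

@[simp] theorem planeProj_planeIncl (k : Fin 3) (u : E2) : planeProj k (planeIncl k u) = u := by
  ext a
  fin_cases a <;> simp

@[simp] theorem planeProj_single (k : Fin 3) (c : ℝ) :
    planeProj k (EuclideanSpace.single k c) = 0 := by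
  ext a
  fin_cases a <;> fin_cases k <;> simp

theorem planeIncl_planeProj_add (k : Fin 3) (x : E3) :
    planeIncl k (planeProj k x) + x k • EuclideanSpace.single k 1 = x := by
  ext a
  fin_cases a <;> fin_cases k <;> simp [planeIncl]

/-- The graph of `h` over the coordinate plane orthogonal to the `k`-th axis. -/
def graphMap (k : Fin 3) (h : E2 → ℝ) (u : E2) : E3 :=
  planeIncl k u + h u • EuclideanSpace.single k 1

@[simp] theorem planeProj_graphMap (k : Fin 3) (h : E2 → ℝ) (u : E2) :
    planeProj k (graphMap k h u) = u := by
  simp [graphMap]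

@[simp] theorem graphMap_apply_self (k : Fin 3) (h : E2 → ℝ) (u : E2) :
    graphMap k h u k = h u := by
  simp [graphMap]

theorem contDiffAt_graphMap {k : Fin 3} {h : E2 → ℝ} {u : E2} {n : WithTop ℕ∞}
    (hh : ContDiffAt ℝ n h u) : ContDiffAt ℝ n (graphMap k h) u :=
  (planeIncl k).contDiff.contDiffAt.add (hh.smul contDiffAt_const)

theorem fderiv_graphMap {k : Fin 3} {h : E2 → ℝ} {u : E2} (hh : DifferentiableAt ℝ h u) (v : E2) :
    fderiv ℝ (graphMap k h) u v =
      planeIncl k v + fderiv ℝ h u v • EuclideanSpace.single k 1 := by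
  have h1 : HasFDerivAt (graphMap k h)
      (planeIncl k + (fderiv ℝ h u).smulRight (EuclideanSpace.single k 1)) u :=
    (planeIncl k).hasFDerivAt.add (hh.hasFDerivAt.smul_const _)
  rw [h1.fderiv]
  rfl

theorem injective_fderiv_graphMap {k : Fin 3} {h : E2 → ℝ} {u : E2}
    (hh : DifferentiableAt ℝ h u) : Function.Injective (fderiv ℝ (graphMap k h) u) := by
  intro v w hvw
  have := congrArg (planeProj k) hvw
  simpa [fderiv_graphMap hh] using this

/-- The partial derivatives of a function on the plane. -/
def _root_.E2.pderiv (a : Fin 2) (h : E2 → ℝ) (u : E2) : ℝ :=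
  fderiv ℝ h u (EuclideanSpace.single a 1)

/-- The area density `√(1 + |∇h|²)` of the graph of `h`. -/
def graphDensity (h : E2 → ℝ) (u : E2) : ℝ :=
  √(1 + E2.pderiv 0 h u ^ 2 + E2.pderiv 1 h u ^ 2)

theorem one_add_sq_pderiv_pos (h : E2 → ℝ) (u : E2) :
    0 < 1 + E2.pderiv 0 h u ^ 2 + E2.pderiv 1 h u ^ 2 := by positivity

theorem graphDensity_pos (h : E2 → ℝ) (u : E2) : 0 < graphDensity h u :=
  Real.sqrt_pos.2 (one_add_sq_pderiv_pos h u)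

/-- With `p, q` the partial derivatives of `h`, the Gram determinant of the tangent vectors `e_{k+1}
+ p e_k` and `e_{k+2} + q e_k` is `(1 + p²)(1 + q²) - p²q² = 1 + p² + q²`. -/
theorem normDet_fderiv_graphMap {k : Fin 3} {h : E2 → ℝ} {u : E2} (hh : DifferentiableAt ℝ h u) :
    (fderiv ℝ (graphMap k h) u).toLinearMap.normDet = graphDensity h u := by
  have h1 := (fderiv ℝ (graphMap k h) u).toLinearMap.normDet_sq_eq_det_gram
    (EuclideanSpace.basisFun (Fin 2) ℝ)
  have h2 : (fderiv ℝ (graphMap k h) u).toLinearMap.normDet ^ 2 =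
      1 + E2.pderiv 0 h u ^ 2 + E2.pderiv 1 h u ^ 2 := by
    refine (RCLike.ofReal_real_eq_id ▸ h1 : _).trans ?_
    simp only [Matrix.det_fin_two, Matrix.gram_apply, EuclideanSpace.basisFun_apply,
      ContinuousLinearMap.coe_coe, fderiv_graphMap hh, E3.inner_eq_sum, sum_eq_cyclic k,
      PiLp.add_apply, PiLp.smul_apply, planeIncl_apply_self, planeIncl_apply_add_one,
      planeIncl_apply_add_two, E2.pderiv]
    fin_cases k <;> simp <;> ring
  rw [graphDensity, ← h2, Real.sqrt_sq (LinearMap.normDet_nonneg _)]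

end E3

theorem ContDiffAt.pderiv {n m : WithTop ℕ∞} {h : E2 → ℝ} {u : E2} (hh : ContDiffAt ℝ n h u)
    (hmn : m + 1 ≤ n) (a : Fin 2) : ContDiffAt ℝ m (E2.pderiv a h) u :=
  (hh.fderiv_right hmn).clm_apply contDiffAt_const

theorem ContDiffAt.graphDensity {h : E2 → ℝ} {u : E2} (hh : ContDiffAt ℝ 2 h u) :
    ContDiffAt ℝ 1 (E3.graphDensity h) u :=
  ((contDiffAt_const.add ((hh.pderiv (by norm_num) 0).pow 2)).add
    ((hh.pderiv (by norm_num) 1).pow 2)).sqrt (E3.one_add_sq_pderiv_pos h u).ne'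

/-! ### Graph charts and the area measure in them -/

namespace ClosedSurface

open E3

/-- A part of the surface that is the graph of a `C²` function over an open set of a coordinate
plane. -/
structure GraphChart (Γ : ClosedSurface) where
  k : Fin 3
  h : E2 → ℝ
  U : Set E2
  Ω : Set E3
  isOpen_U : IsOpen U
  isOpen_Ω : IsOpen Ω
  contDiffAt : ∀ u ∈ U, ContDiffAt ℝ 2 h u
  graph_mem : ∀ u ∈ U, graphMap k h u ∈ Γ.carrier
  graph_mem_Ω : ∀ u ∈ U, graphMap k h u ∈ Ω
  proj_mem : ∀ x ∈ Γ.carrier ∩ Ω, planeProj k x ∈ U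
  graph_proj : ∀ x ∈ Γ.carrier ∩ Ω, graphMap k h (planeProj k x) = x

/-- Some partial derivative `∂_k f` is nonzero at `y`, and the implicit function theorem solves `f =
0` for the `k`-th coordinate. -/
theorem exists_graphChart (Γ : ClosedSurface) (y : Γ) : ∃ c : Γ.GraphChart, (y : E3) ∈ c.Ω := by
  obtain ⟨f, hf, hne, hiff, -⟩ := Γ.exists_equation y
  obtain ⟨k, hk⟩ : ∃ k, fderiv ℝ f (y : E3) (EuclideanSpace.single k 1) ≠ 0 := by
    by_contra! H
    apply hne
    have : fderiv ℝ f (y : E3) = 0 := by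
      ext v
      rw [E3.eq_sum_single v, map_sum]
      simp [H]
    simp [gradient, this]
  set L : E2 × ℝ →L[ℝ] E3 := (planeIncl k).comp (ContinuousLinearMap.fst ℝ E2 ℝ) +
    (ContinuousLinearMap.snd ℝ E2 ℝ).smulRight (EuclideanSpace.single k 1)
  set p₀ : E2 × ℝ := (planeProj k y, (y : E3) k)
  have hL : L p₀ = y := planeIncl_planeProj_add k y
  have hF : ContDiffAt ℝ 3 (f ∘ L) p₀ :=
    ContDiffAt.comp p₀ (by rw [hL]; exact hf) L.contDiff.contDiffAt
  have hinv : (fderiv ℝ (f ∘ L) p₀ ∘L .inr ℝ E2 ℝ).IsInvertible := by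
    set c := fderiv ℝ f (y : E3) (EuclideanSpace.single k 1)
    have h1 : ∀ t, (fderiv ℝ (f ∘ L) p₀ ∘L .inr ℝ E2 ℝ) t = t * c := fun t => by
      rw [fderiv_comp p₀ (by rw [hL]; exact hf.differentiableAt (by norm_num))
        L.differentiableAt, hL, L.fderiv]
      simp [L, c]
    refine ContinuousLinearMap.IsInvertible.of_inverse
      (g := c⁻¹ • ContinuousLinearMap.id ℝ ℝ) ?_ ?_
    · ext
      simp [h1, hk, c]
    · ext
      change c⁻¹ * (fderiv ℝ (f ∘ L) p₀ ∘L .inr ℝ E2 ℝ) 1 = 1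
      rw [h1, one_mul, inv_mul_cancel₀ hk]
  set h := hF.implicitFunction (by norm_num) hinv
  have hh0 : h (planeProj k y) = (y : E3) k :=
    hF.implicitFunction_apply_self (by norm_num) hinv
  have hhC : ContDiffAt ℝ 3 h (planeProj k y) :=
    hF.contDiffAt_implicitFunction (by norm_num) hinv
  have hgraph : ∀ᶠ p in 𝓝 p₀, L p ∈ Γ.carrier ↔ h p.1 = p.2 := by
    have h1 : ∀ᶠ p in 𝓝 p₀, L p ∈ Γ.carrier ↔ f (L p) = 0 :=
      (L.continuous.tendsto p₀).eventually (by rw [hL]; exact hiff)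
    have h0 : (f ∘ L) p₀ = 0 := by
      rw [Function.comp_apply, hL]; exact hiff.self_of_nhds.1 y.2
    filter_upwards [h1, hF.eventually_apply_eq_iff_implicitFunction (by norm_num) hinv]
      with p h1 h2
    rw [h1, ← h2, h0, Function.comp_apply]
  obtain ⟨U₀, hU₀, I₀, hI₀, hUI⟩ := mem_nhds_prod_iff.1 hgraph
  obtain ⟨I, hII₀, hI, hyI⟩ := mem_nhds_iff.1 hI₀
  -- Shrinking the base so that `h` takes values in `I` keeps the whole graph inside the box `Ω`, so
  -- that `Γ ∩ Ω` is exactly this graph.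
  have hall : ∀ᶠ u in 𝓝 (planeProj k y), u ∈ U₀ ∧ ContDiffAt ℝ 2 h u ∧ h u ∈ I := by
    refine (eventually_mem_set.2 hU₀).and (((hhC.eventually (by simp)).mono fun u hu =>
      hu.of_le (by norm_num)).and (hhC.continuousAt.eventually ?_))
    rw [hh0]
    exact hI.mem_nhds hyI
  obtain ⟨U, hU, hUo, hyU⟩ := mem_nhds_iff.1 hall
  have hLg : ∀ u, L (u, h u) = graphMap k h u := fun u => rfl
  have hLx : ∀ x, L (planeProj k x, x k) = x := planeIncl_planeProj_add k
  refine ⟨{ k := k, h := h, U := U, Ω := {x | planeProj k x ∈ U ∧ x k ∈ I}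
            isOpen_U := hUo
            isOpen_Ω := (hUo.preimage (planeProj k).continuous).inter
              (hI.preimage (EuclideanSpace.proj k : E3 →L[ℝ] ℝ).continuous)
            contDiffAt := fun u hu => (hU hu).2.1
            graph_mem := fun u hu => ?_
            graph_mem_Ω := fun u hu => ?_
            proj_mem := fun x hx => hx.2.1
            graph_proj := fun x hx => ?_ }, hyU, hyI⟩
  · rw [← hLg]
    have h1 : (u, h u) ∈ U₀ ×ˢ I₀ := mk_mem_prod (hU hu).1 (hII₀ (hU hu).2.2)
    exact (hUI h1).2 rfl
  · exact ⟨by rwa [planeProj_graphMap], by rw [graphMap_apply_self]; exact (hU hu).2.2⟩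
  · have h1 : L (planeProj k x, x k) ∈ Γ.carrier := by rw [hLx]; exact hx.1
    have h2 := (hUI (mk_mem_prod (hU hx.2.1).1 (hII₀ hx.2.2))).1 h1
    simp only at h2
    rw [← hLg, h2, hLx]

namespace GraphChart

variable {Γ : ClosedSurface} (c : Γ.GraphChart)

theorem differentiableAt {u : E2} (hu : u ∈ c.U) : DifferentiableAt ℝ c.h u :=
  (c.contDiffAt u hu).differentiableAt (by norm_num)

/-- The point of the surface with chart coordinate `u`. -/
def point (u : E2) (hu : u ∈ c.U) : Γ := ⟨graphMap c.k c.h u, c.graph_mem u hu⟩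

theorem exists_point {y : Γ} (hy : (y : E3) ∈ c.Ω) : ∃ u, ∃ hu : u ∈ c.U, c.point u hu = y :=
  ⟨planeProj c.k y, c.proj_mem y ⟨y.2, hy⟩, Subtype.ext (c.graph_proj y ⟨y.2, hy⟩)⟩

theorem image_graphMap : graphMap c.k c.h '' c.U = Γ.carrier ∩ c.Ω := by
  ext x
  constructor
  · rintro ⟨u, hu, rfl⟩
    exact ⟨c.graph_mem u hu, c.graph_mem_Ω u hu⟩
  · exact fun hx => ⟨planeProj c.k x, c.proj_mem x hx, c.graph_proj x hx⟩

theorem continuousOn_graphDensity : ContinuousOn (graphDensity c.h) c.U :=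
  fun u hu => (c.contDiffAt u hu).graphDensity.continuousAt.continuousWithinAt

/-- A function on the surface in the coordinates of the chart. -/
def pull (η : Γ → ℝ) (u : E2) : ℝ := Function.extend Subtype.val η 0 (graphMap c.k c.h u)

theorem pull_apply (η : Γ → ℝ) {u : E2} (hu : u ∈ c.U) : c.pull η u = η (c.point u hu) :=
  Subtype.val_injective.extend_apply η 0 (c.point u hu)

theorem tendsto_point {u : E2} (hu : u ∈ c.U) {p : Γ → Prop}
    (hp : ∀ᶠ y in 𝓝 (c.point u hu), p y) :
    ∀ᶠ v in 𝓝 u, ∃ hv : v ∈ c.U, p (c.point v hv) := by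
  rw [nhds_subtype_eq_comap, eventually_comap] at hp
  have hcont : ContinuousAt (graphMap c.k c.h) u :=
    (contDiffAt_graphMap (c.contDiffAt u hu)).continuousAt
  filter_upwards [hcont.eventually hp, c.isOpen_U.mem_nhds hu] with v h1 h2
  exact ⟨h2, h1 _ rfl⟩

theorem pull_eventuallyEq {u : E2} (hu : u ∈ c.U) {η : Γ → ℝ} {F : E3 → ℝ}
    (hF : ∀ᶠ x : Γ in 𝓝 (c.point u hu), F x = η x) :
    c.pull η =ᶠ[𝓝 u] F ∘ graphMap c.k c.h := by
  filter_upwards [c.tendsto_point hu hF] with v ⟨hv, h⟩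
  rw [c.pull_apply η hv, ← h]
  rfl

theorem contDiffAt_pull {k : ℕ} (hk : k ≤ 2) {η : Γ → ℝ} (hη : Γ.IsCk k η) {u : E2}
    (hu : u ∈ c.U) : ContDiffAt ℝ k (c.pull η) u := by
  obtain ⟨F, hF, hFη⟩ := hη (c.point u hu)
  exact (ContDiffAt.comp u hF (contDiffAt_graphMap
    ((c.contDiffAt u hu).of_le (by exact_mod_cast hk)))).congr_of_eventuallyEq
    (c.pull_eventuallyEq hu hFη)

theorem continuousOn_pull {η : Γ → ℝ} (hη : Continuous η) : ContinuousOn (c.pull η) c.U := by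
  rw [continuousOn_iff_continuous_domRestrict]
  have hg : Continuous fun u : c.U => graphMap c.k c.h u :=
    continuousOn_iff_continuous_domRestrict.1 fun u hu =>
      (contDiffAt_graphMap (c.contDiffAt u hu)).continuousAt.continuousWithinAt
  have : c.U.domRestrict (c.pull η) = fun u : c.U => η ⟨graphMap c.k c.h u, c.graph_mem u u.2⟩ := by
    ext u
    exact c.pull_apply η u.2
  rw [this]
  exact hη.comp (hg.subtype_mk _)

theorem map_restrict_euclideanHausdorffMeasure :
    ((μHE[2] : Measure E3).restrict (Γ.carrier ∩ c.Ω)).map (planeProj c.k) =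
      (volume.restrict c.U).withDensity fun u => ENNReal.ofReal (graphDensity c.h u) := by
  have hJ : ∀ u ∈ c.U, (fderiv ℝ (graphMap c.k c.h) u).toLinearMap.normDet =
      graphDensity c.h u := fun u hu => normDet_fderiv_graphMap (c.differentiableAt hu)
  have h := map_restrict_image_euclideanHausdorffMeasure (f := graphMap c.k c.h)
    (f' := fderiv ℝ (graphMap c.k c.h)) (p := planeProj c.k) c.isOpen_U
    (planeProj c.k).continuous.measurable (fun u _ => planeProj_graphMap _ _ u)
    (fun u hu => (contDiffAt_graphMap (c.contDiffAt u hu)).hasStrictFDerivAt (by norm_num))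
    (fun u hu => injective_fderiv_graphMap (c.differentiableAt hu))
    (c.continuousOn_graphDensity.congr hJ)
  rw [finrank_euclideanSpace_fin, c.image_graphMap] at h
  rw [h]
  refine withDensity_congr_ae ?_
  filter_upwards [ae_restrict_mem c.isOpen_U.measurableSet] with u hu
  rw [hJ u hu]

end GraphChart

theorem measurableSet_carrier (Γ : ClosedSurface) : MeasurableSet Γ.carrier :=
  Γ.isCompact.isClosed.measurableSet

theorem map_val_area (Γ : ClosedSurface) :
    Γ.area.map Subtype.val = (μHE[2] : Measure E3).restrict Γ.carrier := by
  rw [area, map_comap_subtype_coe Γ.measurableSet_carrier]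

namespace GraphChart

variable {Γ : ClosedSurface} (c : Γ.GraphChart)

theorem measurableSet_preimage_Ω : MeasurableSet {y : Γ | (y : E3) ∈ c.Ω} :=
  (c.isOpen_Ω.preimage continuous_subtype_val).measurableSet

/-- The area measure in the coordinates of a graph chart. -/
theorem map_restrict_area :
    (Γ.area.restrict {y : Γ | (y : E3) ∈ c.Ω}).map (fun y : Γ => planeProj c.k y) =
      (volume.restrict c.U).withDensity fun u => ENNReal.ofReal (graphDensity c.h u) := by
  rw [← c.map_restrict_euclideanHausdorffMeasure, inter_comm,
    ← Measure.restrict_restrict c.isOpen_Ω.measurableSet, ← map_val_area,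
    Measure.restrict_map measurable_subtype_coe c.isOpen_Ω.measurableSet,
    Measure.map_map (planeProj c.k).continuous.measurable measurable_subtype_coe]
  rfl

theorem integral_area_eq {η : Γ → ℝ} (hη : Continuous η) (h0 : ∀ y : Γ, (y : E3) ∉ c.Ω → η y = 0) :
    ∫ y, η y ∂Γ.area = ∫ u in c.U, graphDensity c.h u * c.pull η u := by
  have h1 : ∫ y, η y ∂Γ.area = ∫ y in {y : Γ | (y : E3) ∈ c.Ω}, η y ∂Γ.area :=
    (setIntegral_eq_integral_of_forall_compl_eq_zero fun y hy => h0 y hy).symm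
  have h2 : ∫ y in {y : Γ | (y : E3) ∈ c.Ω}, η y ∂Γ.area =
      ∫ y in {y : Γ | (y : E3) ∈ c.Ω}, c.pull η (planeProj c.k y) ∂Γ.area := by
    refine setIntegral_congr_fun c.measurableSet_preimage_Ω fun y hy => ?_
    obtain ⟨u, hu, rfl⟩ := c.exists_point hy
    simp only [point, planeProj_graphMap]
    rw [c.pull_apply η hu]
    rfl
  have hd : AEMeasurable (fun u => ENNReal.ofReal (graphDensity c.h u)) (volume.restrict c.U) :=
    (c.continuousOn_graphDensity.aemeasurable c.isOpen_U.measurableSet).ennreal_ofReal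
  have hpull : AEStronglyMeasurable (c.pull η) ((volume.restrict c.U).withDensity fun u =>
      ENNReal.ofReal (graphDensity c.h u)) :=
    ((c.continuousOn_pull hη).aestronglyMeasurable c.isOpen_U.measurableSet).mono_ac
      (withDensity_absolutelyContinuous _ _)
  rw [h1, h2, ← integral_map (φ := fun y : Γ => planeProj c.k y) (f := c.pull η)
    ((planeProj c.k).continuous.comp continuous_subtype_val).measurable.aemeasurable
    (by rw [c.map_restrict_area]; exact hpull), c.map_restrict_area,
    integral_withDensity_eq_integral_toReal_smul₀ hd (by simp)]
  refine integral_congr_ae (Eventually.of_forall fun u => ?_)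
  simp only [ENNReal.toReal_ofReal (graphDensity_pos c.h u).le, smul_eq_mul]

end GraphChart

end ClosedSurface

/-! ### Calculus in the plane and the divergence in a chart -/

namespace E2

theorem pderiv_mul {f g : E2 → ℝ} {u : E2} (hf : DifferentiableAt ℝ f u)
    (hg : DifferentiableAt ℝ g u) (a : Fin 2) :
    pderiv a (fun v => f v * g v) u = f u * pderiv a g u + g u * pderiv a f u := by
  simp [pderiv, fderiv_fun_mul hf hg]

theorem pderiv_add {f g : E2 → ℝ} {u : E2} (hf : DifferentiableAt ℝ f u)
    (hg : DifferentiableAt ℝ g u) (a : Fin 2) :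
    pderiv a (fun v => f v + g v) u = pderiv a f u + pderiv a g u := by
  simp [pderiv, fderiv_fun_add hf hg]

theorem pderiv_congr {f g : E2 → ℝ} {u : E2} (h : f =ᶠ[𝓝 u] g) (a : Fin 2) :
    pderiv a f u = pderiv a g u := by
  rw [pderiv, h.fderiv_eq, pderiv]

theorem pderiv_comm {h : E2 → ℝ} {u : E2} (hh : ContDiffAt ℝ 2 h u) (a b : Fin 2) :
    pderiv a (pderiv b h) u = pderiv b (pderiv a h) u := by
  have hd : DifferentiableAt ℝ (fderiv ℝ h) u :=
    (hh.fderiv_right (m := 1) (by norm_num)).differentiableAt (by norm_num)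
  have key : ∀ a b : Fin 2, pderiv a (pderiv b h) u =
      fderiv ℝ (fderiv ℝ h) u (EuclideanSpace.single a 1) (EuclideanSpace.single b 1) := by
    intro a b
    have : pderiv b h = fun v => fderiv ℝ h v (EuclideanSpace.single b 1) := rfl
    rw [this, pderiv, fderiv_clm_apply hd (differentiableAt_const _)]
    simp
  rw [key, key]
  exact (hh.isSymmSndFDerivAt (by simp)).eq _ _

/-- Differentiate the square of the density, which is polynomial in the first derivatives of `h`. -/
theorem pderiv_graphDensity {h : E2 → ℝ} {u : E2} (hh : ContDiffAt ℝ 2 h u) (a : Fin 2) :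
    pderiv a (E3.graphDensity h) u =
      (pderiv 0 h u * pderiv a (pderiv 0 h) u + pderiv 1 h u * pderiv a (pderiv 1 h) u) /
        E3.graphDensity h u := by
  have hd : ∀ b, DifferentiableAt ℝ (pderiv b h) u := fun b =>
    (hh.pderiv (m := 1) (by norm_num) b).differentiableAt (by norm_num)
  have hs := hh.graphDensity.differentiableAt (by norm_num)
  have hsq : (fun v => E3.graphDensity h v * E3.graphDensity h v) = fun v =>
      (1 + pderiv 0 h v * pderiv 0 h v) + pderiv 1 h v * pderiv 1 h v := by
    ext v
    rw [E3.graphDensity, Real.mul_self_sqrt (E3.one_add_sq_pderiv_pos h v).le]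
    ring
  have h1 : pderiv a (fun v => E3.graphDensity h v * E3.graphDensity h v) u = pderiv a _ u :=
    congrArg (fun f => pderiv a f u) hsq
  rw [pderiv_mul hs hs, pderiv_add ((differentiableAt_const _).fun_add ((hd 0).fun_mul (hd 0)))
    ((hd 1).fun_mul (hd 1)), pderiv_add (differentiableAt_const _) ((hd 0).fun_mul (hd 0)),
    pderiv_mul (hd 0) (hd 0), pderiv_mul (hd 1) (hd 1)] at h1
  have h2 : pderiv a (fun _ : E2 => (1 : ℝ)) u = 0 := by simp [pderiv]
  rw [h2] at h1
  rw [eq_div_iff (E3.graphDensity_pos h u).ne']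
  linarith

/-- Integration by parts against the constant `1`. -/
theorem integral_pderiv_eq_zero {f : E2 → ℝ} (hf : ContDiff ℝ 1 f) (hc : HasCompactSupport f)
    (a : Fin 2) : ∫ u, pderiv a f u = 0 := by
  have hcont : Continuous (pderiv a f) :=
    (hf.continuous_fderiv (by norm_num)).clm_apply continuous_const
  have hint : Integrable (pderiv a f) := hcont.integrable_of_hasCompactSupport
    (hc.fderiv_apply (𝕜 := ℝ) (EuclideanSpace.single a 1))
  have := integral_mul_fderiv_eq_neg_fderiv_mul_of_integrable (μ := volume)
    (f := fun _ : E2 => (1 : ℝ)) (g := f) (v := EuclideanSpace.single a 1) (by simp)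
    (by simp only [one_mul]; exact hint) (by simpa using hf.continuous.integrable_of_hasCompactSupport hc)
    (fun x _ => differentiableAt_const _)
    (fun x _ => hf.contDiffAt.differentiableAt (by norm_num))
  simpa [pderiv] using this

end E2

namespace ClosedSurface

open E3 E2

namespace GraphChart

variable {Γ : ClosedSurface} (c : Γ.GraphChart)

/-- The normal is orthogonal to the two coordinate tangent vectors of the graph and has unit length.
This fixes it up to sign, and the sign is never needed. -/
theorem normal_point {u : E2} (hu : u ∈ c.U) :
    Γ.normal (c.point u hu) (c.k + 1) = -(pderiv 0 c.h u * Γ.normal (c.point u hu) c.k) ∧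
    Γ.normal (c.point u hu) (c.k + 2) = -(pderiv 1 c.h u * Γ.normal (c.point u hu) c.k) ∧
    Γ.normal (c.point u hu) c.k ^ 2 * (1 + pderiv 0 c.h u ^ 2 + pderiv 1 c.h u ^ 2) = 1 := by
  set n := Γ.normal (c.point u hu)
  have hd := c.differentiableAt hu
  have h := inner_normal_fderiv_eq_zero (Γ := Γ) (φ := graphMap c.k c.h) (u := u)
    (y := c.point u hu) ((contDiffAt_graphMap (c.contDiffAt u hu)).differentiableAt (by norm_num))
    rfl ((c.isOpen_U.mem_nhds hu |> eventually_mem_set.2).mono fun v hv => c.graph_mem v hv)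
  have h' : ∀ a, n (c.k + 1) * (EuclideanSpace.single a 1 : E2) 0 +
      n (c.k + 2) * (EuclideanSpace.single a 1 : E2) 1 + pderiv a c.h u * n c.k = 0 := fun a => by
    have := h (EuclideanSpace.single a 1)
    rw [fderiv_graphMap hd, planeIncl_apply, inner_add_right, inner_add_right,
      real_inner_smul_right, real_inner_smul_right, real_inner_smul_right] at this
    simp only [EuclideanSpace.inner_single_right, conj_trivial, one_mul] at this
    rw [← this, pderiv]
    ring
  have h0 : n (c.k + 1) = -(pderiv 0 c.h u * n c.k) := by
    have := h' 0
    simp at this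
    linarith
  have h1 : n (c.k + 2) = -(pderiv 1 c.h u * n c.k) := by
    have := h' 1
    simp at this
    linarith
  refine ⟨h0, h1, ?_⟩
  have := Γ.sum_normal_mul_normal (c.point u hu)
  rw [sum_eq_cyclic c.k, show Γ.normal (c.point u hu) = n from rfl, h0, h1] at this
  linarith

theorem normal_point_ne_zero {u : E2} (hu : u ∈ c.U) : Γ.normal (c.point u hu) c.k ≠ 0 := by
  intro h
  have := (c.normal_point hu).2.2
  rw [h] at this
  norm_num at this

theorem pderiv_pull {u : E2} (hu : u ∈ c.U) {η : Γ → ℝ} {F : E3 → ℝ}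
    (hF : ContDiffAt ℝ 1 F (c.point u hu : E3))
    (hFη : ∀ᶠ x : Γ in 𝓝 (c.point u hu), F x = η x) :
    pderiv 0 (c.pull η) u =
      fderiv ℝ F (c.point u hu : E3) (EuclideanSpace.single (c.k + 1) 1) +
      pderiv 0 c.h u * fderiv ℝ F (c.point u hu : E3) (EuclideanSpace.single c.k 1) ∧
    pderiv 1 (c.pull η) u =
      fderiv ℝ F (c.point u hu : E3) (EuclideanSpace.single (c.k + 2) 1) +
      pderiv 1 c.h u * fderiv ℝ F (c.point u hu : E3) (EuclideanSpace.single c.k 1) := by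
  have hd : DifferentiableAt ℝ (graphMap c.k c.h) u :=
    (contDiffAt_graphMap (c.contDiffAt u hu)).differentiableAt (by norm_num)
  have hFd : DifferentiableAt ℝ F (graphMap c.k c.h u) := hF.differentiableAt (by norm_num)
  have key : ∀ a, pderiv a (c.pull η) u = fderiv ℝ F (c.point u hu : E3)
      (planeIncl c.k (EuclideanSpace.single a 1) +
        pderiv a c.h u • EuclideanSpace.single c.k 1) := fun a => by
    rw [pderiv_congr (c.pull_eventuallyEq hu hFη), pderiv, fderiv_comp u hFd hd,
      ContinuousLinearMap.comp_apply, fderiv_graphMap (c.differentiableAt hu)]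
    rfl
  constructor <;> · rw [key, map_add, map_smul, planeIncl_apply]; simp

/-- The tangential divergence in the coordinates of a graph chart. -/
theorem graphDensity_mul_div {W : Γ → E3} (hW : Γ.IsTangentialCk 1 W) {u : E2} (hu : u ∈ c.U) :
    graphDensity c.h u * ∑ i, Γ.tangDeriv i (fun y => W y i) (c.point u hu) =
      pderiv 0 (fun v => graphDensity c.h v * c.pull (fun y => W y (c.k + 1)) v) u +
      pderiv 1 (fun v => graphDensity c.h v * c.pull (fun y => W y (c.k + 2)) v) u := by
  have hh := c.contDiffAt u hu
  choose F hF hFW using fun i => hW.isCk i (c.point u hu)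
  have hw : ∀ i, DifferentiableAt ℝ (c.pull fun y => W y i) u := fun i =>
    (c.contDiffAt_pull (by norm_num) (hW.isCk i) hu).differentiableAt (by norm_num)
  have hp : ∀ b, DifferentiableAt ℝ (pderiv b c.h) u := fun b =>
    (hh.pderiv (m := 1) (by norm_num) b).differentiableAt (by norm_num)
  have hs := hh.graphDensity.differentiableAt (by norm_num)
  obtain ⟨hn1, hn2, hn⟩ := c.normal_point hu
  -- Tangency expresses the `k`-th component through the other two; differentiating this brings in
  -- the second derivatives of `h`.
  have htan : c.pull (fun y => W y c.k) =ᶠ[𝓝 u] fun v =>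
      pderiv 0 c.h v * c.pull (fun y => W y (c.k + 1)) v +
        pderiv 1 c.h v * c.pull (fun y => W y (c.k + 2)) v := by
    filter_upwards [c.isOpen_U.mem_nhds hu] with v hv
    have h1 := (Γ.mem_tangentPlane_iff).1 (hW.tangent (c.point v hv))
    obtain ⟨hv1, hv2, -⟩ := c.normal_point hv
    rw [sum_eq_cyclic c.k, hv1, hv2] at h1
    rw [c.pull_apply _ hv, c.pull_apply _ hv, c.pull_apply _ hv]
    apply mul_left_cancel₀ (c.normal_point_ne_zero hv)
    linarith
  have hC : ∀ a, pderiv a (c.pull fun y => W y c.k) u =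
      (pderiv 0 c.h u * pderiv a (c.pull fun y => W y (c.k + 1)) u +
        c.pull (fun y => W y (c.k + 1)) u * pderiv a (pderiv 0 c.h) u) +
      (pderiv 1 c.h u * pderiv a (c.pull fun y => W y (c.k + 2)) u +
        c.pull (fun y => W y (c.k + 2)) u * pderiv a (pderiv 1 c.h) u) := fun a => by
    rw [pderiv_congr htan, pderiv_add ((hp 0).fun_mul (hw _)) ((hp 1).fun_mul (hw _)),
      pderiv_mul (hp 0) (hw _), pderiv_mul (hp 1) (hw _)]
  have hch := fun i => c.pderiv_pull hu (hF i) (hFW i)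
  rw [pderiv_mul hs (hw _), pderiv_mul hs (hw _), pderiv_graphDensity hh, pderiv_graphDensity hh,
    pderiv_comm hh 1 0]
  have hC0 := hC 0
  have hC1 := hC 1
  rw [pderiv_comm hh 1 0] at hC1
  have htd : ∀ i, Γ.tangDeriv i (fun y => W y i) (c.point u hu) =
      fderiv ℝ (F i) (c.point u hu : E3) (EuclideanSpace.single i 1) -
        Γ.normal (c.point u hu) i * ∑ j, Γ.normal (c.point u hu) j *
          fderiv ℝ (F i) (c.point u hu : E3) (EuclideanSpace.single j 1) := fun i =>
    (tangDeriv_eq (hF i) (hFW i) i).trans (Γ.sum_P_mul _ i fun j =>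
      fderiv ℝ (F i) (c.point u hu : E3) (EuclideanSpace.single j 1))
  simp only [htd, sum_eq_cyclic c.k, hn1, hn2]
  have hs2 : graphDensity c.h u ^ 2 = 1 + pderiv 0 c.h u ^ 2 + pderiv 1 c.h u ^ 2 :=
    Real.sq_sqrt (one_add_sq_pderiv_pos _ _).le
  have hs0 := (graphDensity_pos c.h u).ne'
  obtain ⟨e00, e01⟩ := hch c.k
  obtain ⟨e10, e11⟩ := hch (c.k + 1)
  obtain ⟨e20, e21⟩ := hch (c.k + 2)
  rw [hC0] at e00
  rw [hC1] at e01
  rw [← hs2] at hn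
  -- The chain rule eliminates the ambient derivatives along the axes `k + 1` and `k + 2`. Those
  -- along `k` (below `x`, `y`, `z`) depend on the extension and must cancel.
  rw [eq_sub_of_add_eq e00.symm, eq_sub_of_add_eq e01.symm, eq_sub_of_add_eq e10.symm,
    eq_sub_of_add_eq e11.symm, eq_sub_of_add_eq e20.symm, eq_sub_of_add_eq e21.symm]
  clear e00 e01 e10 e11 e20 e21 htd hC0 hC1 hch hC
  generalize graphDensity c.h u = s at *
  generalize Γ.normal (c.point u hu) c.k = N at *
  generalize pderiv 0 c.h u = p at *
  generalize pderiv 1 c.h u = q at *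
  generalize c.pull (fun y => W y (c.k + 1)) u = A
  generalize c.pull (fun y => W y (c.k + 2)) u = B
  generalize pderiv 0 (c.pull fun y => W y (c.k + 1)) u = A0
  generalize pderiv 1 (c.pull fun y => W y (c.k + 1)) u = A1
  generalize pderiv 0 (c.pull fun y => W y (c.k + 2)) u = B0
  generalize pderiv 1 (c.pull fun y => W y (c.k + 2)) u = B1
  generalize pderiv 0 (pderiv 0 c.h) u = H00
  generalize pderiv 0 (pderiv 1 c.h) u = H01
  generalize pderiv 1 (pderiv 1 c.h) u = H11
  generalize fderiv ℝ (F c.k) (c.point u hu : E3) (EuclideanSpace.single c.k 1) = x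
  generalize fderiv ℝ (F (c.k + 1)) (c.point u hu : E3) (EuclideanSpace.single c.k 1) = y
  generalize fderiv ℝ (F (c.k + 2)) (c.point u hu : E3) (EuclideanSpace.single c.k 1) = z
  have hinv := mul_inv_cancel₀ hs0
  -- After multiplication by `s` the identity is polynomial modulo `s² = 1 + p² + q²`, `N² s² = 1`
  -- and `s s⁻¹ = 1`.
  apply mul_left_cancel₀ hs0
  simp only [div_eq_mul_inv]
  linear_combination (x - p * y - q * z) * hs2 -
    (x - p * (p * A0 + A * H00 + (q * B0 + B * H01) - p * x)
        - q * (p * A1 + A * H01 + (q * B1 + B * H11) - q * x)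
      - p * (y - p * (A0 - p * y) - q * (A1 - q * y))
      - q * (z - p * (B0 - p * z) - q * (B1 - q * z))) * hn -
    (A * (p * H00 + q * H01) + B * (p * H01 + q * H11)) * hinv

end GraphChart

end ClosedSurface

/-! ### The divergence theorem on the closed surface -/

theorem contDiff_indicator_of_eq_zero_off_compact {E : Type*} [NormedAddCommGroup E]
    [NormedSpace ℝ E] {n : WithTop ℕ∞} {G : E → ℝ} {U C : Set E} (hU : IsOpen U) (hC : IsClosed C)
    (hCU : C ⊆ U) (hG : ∀ u ∈ U, ContDiffAt ℝ n G u) (h0 : ∀ u ∈ U, u ∉ C → G u = 0) :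
    ContDiff ℝ n (U.indicator G) := by
  -- The open sets `U` and `Cᶜ` cover the space; the indicator is `G` on the first and zero on the
  -- second.
  refine contDiff_iff_contDiffAt.2 fun u => ?_
  by_cases hu : u ∈ U
  · refine (hG u hu).congr_of_eventuallyEq ?_
    filter_upwards [hU.mem_nhds hu] with v hv using indicator_of_mem hv G
  · refine (contDiffAt_const (c := (0 : ℝ))).congr_of_eventuallyEq ?_
    filter_upwards [hC.isOpen_compl.mem_nhds fun h => hu (hCU h)] with v hv
    by_cases hvU : v ∈ U
    · rw [indicator_of_mem hvU, h0 v hvU hv]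
    · exact indicator_of_notMem hvU G

namespace ClosedSurface

open E3 E2

variable {Γ : ClosedSurface}

instance : CompactSpace Γ := isCompact_iff_compactSpace.1 Γ.isCompact

theorem continuous_of_components {X : Γ → E3} (hX : ∀ i, Continuous fun y => X y i) :
    Continuous X :=
  (PiLp.continuous_toLp 2 _).comp (continuous_pi hX)

theorem continuous_tangDeriv {η : Γ → ℝ} (hη : Γ.IsCk 1 η) (i : Fin 3) :
    Continuous (Γ.tangDeriv i η) :=
  (IsCk.tangDeriv (k := 0) (by norm_num) hη i).continuous

theorem tangDeriv_eq_zero {η : Γ → ℝ} {y : Γ} (h : ∀ᶠ x in 𝓝 y, η x = 0) (i : Fin 3) :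
    Γ.tangDeriv i η y = 0 := by
  rw [tangDeriv_eq (F := fun _ => 0) contDiffAt_const (h.mono fun x hx => hx.symm)]
  simp

namespace GraphChart

variable (c : Γ.GraphChart)

theorem area_apply {B : Set E2} (hB : MeasurableSet B) :
    Γ.area {y : Γ | planeProj c.k y ∈ B ∧ (y : E3) ∈ c.Ω} =
      ∫⁻ u in B ∩ c.U, ENNReal.ofReal (graphDensity c.h u) := by
  have hm : Measurable fun y : Γ => planeProj c.k y :=
    ((planeProj c.k).continuous.comp continuous_subtype_val).measurable
  have := DFunLike.congr_fun c.map_restrict_area B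
  rw [Measure.map_apply hm hB, Measure.restrict_apply (hm hB), withDensity_apply _ hB,
    Measure.restrict_restrict hB] at this
  exact this

/-- The divergence theorem for tangential fields supported in a graph chart. -/
theorem integral_div_eq_zero {W : Γ → E3} (hW : Γ.IsTangentialCk 1 W) {K : Set E3}
    (hK : IsClosed K) (hKΩ : K ⊆ c.Ω) (h0 : ∀ y : Γ, (y : E3) ∉ K → W y = 0) :
    ∫ y, ∑ i, Γ.tangDeriv i (fun x => W x i) y ∂Γ.area = 0 := by
  have hcont : Continuous fun y => ∑ i, Γ.tangDeriv i (fun x => W x i) y :=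
    continuous_finsetSum _ fun i _ => continuous_tangDeriv (hW.isCk i) i
  have hvan : ∀ y : Γ, (y : E3) ∉ c.Ω → ∑ i, Γ.tangDeriv i (fun x => W x i) y = 0 := by
    intro y hy
    refine Finset.sum_eq_zero fun i _ => tangDeriv_eq_zero ?_ i
    have : ∀ᶠ x : Γ in 𝓝 y, (x : E3) ∈ Kᶜ :=
      continuous_subtype_val.continuousAt.eventually
        (hK.isOpen_compl.mem_nhds fun h => hy (hKΩ h))
    filter_upwards [this] with x hx
    rw [h0 x hx]
    rfl
  -- The shadow of the support is a compact subset of `U`, so the weighted components, extended by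
  -- zero, are `C¹` on the whole plane with compact support.
  set C : Set E2 := planeProj c.k '' (Γ.carrier ∩ K)
  have hC : IsCompact C := (Γ.isCompact.inter_right hK).image (planeProj c.k).continuous
  have hCU : C ⊆ c.U := by
    rintro _ ⟨x, hx, rfl⟩
    exact c.proj_mem x ⟨hx.1, hKΩ hx.2⟩
  set G : Fin 3 → E2 → ℝ := fun i v => graphDensity c.h v * c.pull (fun y => W y i) v
  have hG0 : ∀ i, ∀ u ∈ c.U, u ∉ C → G i u = 0 := fun i u hu huC => by
    have : W (c.point u hu) = 0 := h0 _ fun h =>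
      huC ⟨_, ⟨c.graph_mem u hu, h⟩, planeProj_graphMap _ _ _⟩
    simp [G, c.pull_apply _ hu, this]
  have hGC : ∀ i, ContDiff ℝ 1 (c.U.indicator (G i)) := fun i =>
    contDiff_indicator_of_eq_zero_off_compact c.isOpen_U hC.isClosed hCU
      (fun u hu => (c.contDiffAt u hu).graphDensity.mul
        (c.contDiffAt_pull (k := 1) (by norm_num) (hW.isCk i) hu)) (hG0 i)
  have hGs : ∀ i, HasCompactSupport (c.U.indicator (G i)) := fun i =>
    HasCompactSupport.intro hC fun u hu => by
      by_cases huU : u ∈ c.U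
      · rw [indicator_of_mem huU, hG0 i u huU hu]
      · exact indicator_of_notMem huU _
  have hint : ∀ i a, Integrable (pderiv a (c.U.indicator (G i))) := fun i a =>
    (((hGC i).continuous_fderiv (by norm_num)).clm_apply
      continuous_const).integrable_of_hasCompactSupport
      ((hGs i).fderiv_apply (𝕜 := ℝ) (EuclideanSpace.single a 1))
  have hoff : ∀ i a, ∀ u ∉ c.U, pderiv a (c.U.indicator (G i)) u = 0 := fun i a u hu => by
    have : c.U.indicator (G i) =ᶠ[𝓝 u] fun _ => 0 := by
      filter_upwards [hC.isClosed.isOpen_compl.mem_nhds fun h => hu (hCU h)] with v hv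
      by_cases hvU : v ∈ c.U
      · rw [indicator_of_mem hvU, hG0 i v hvU hv]
      · exact indicator_of_notMem hvU _
    rw [pderiv_congr this]
    simp [pderiv]
  rw [c.integral_area_eq hcont hvan]
  calc _ = ∫ u in c.U, (pderiv 0 (c.U.indicator (G (c.k + 1))) u +
        pderiv 1 (c.U.indicator (G (c.k + 2))) u) := by
        refine setIntegral_congr_fun c.isOpen_U.measurableSet fun u hu => ?_
        have hind : ∀ i, c.U.indicator (G i) =ᶠ[𝓝 u] G i := fun i => by
          filter_upwards [c.isOpen_U.mem_nhds hu] with v hv using indicator_of_mem hv _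
        simp only
        rw [pderiv_congr (hind _), pderiv_congr (hind _), c.pull_apply _ hu,
          c.graphDensity_mul_div hW hu]
    _ = ∫ u, (pderiv 0 (c.U.indicator (G (c.k + 1))) u +
        pderiv 1 (c.U.indicator (G (c.k + 2))) u) :=
        setIntegral_eq_integral_of_forall_compl_eq_zero fun u hu => by
          rw [hoff _ _ u hu, hoff _ _ u hu, add_zero]
    _ = 0 := by
        rw [integral_add (hint _ _) (hint _ _), integral_pderiv_eq_zero (hGC _) (hGs _),
          integral_pderiv_eq_zero (hGC _) (hGs _), add_zero]

end GraphChart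

/-- The density of a graph chart is locally bounded. On the compact surface this makes continuous
functions integrable. -/
instance : IsLocallyFiniteMeasure Γ.area := ⟨fun y => by
  obtain ⟨c, hy⟩ := Γ.exists_graphChart y
  obtain ⟨u, hu, rfl⟩ := c.exists_point hy
  have h1 : ∀ᶠ v in 𝓝 u, graphDensity c.h v < graphDensity c.h u + 1 :=
    (c.contDiffAt u hu).graphDensity.continuousAt.eventually_lt_const (lt_add_one _)
  obtain ⟨ε, hε, hball⟩ := Metric.mem_nhds_iff.1 h1
  refine ⟨{y : Γ | planeProj c.k y ∈ Metric.ball u ε ∧ (y : E3) ∈ c.Ω}, ?_, ?_⟩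
  · have hopen : IsOpen {y : Γ | planeProj c.k y ∈ Metric.ball u ε ∧ (y : E3) ∈ c.Ω} :=
      (Metric.isOpen_ball.preimage ((planeProj c.k).continuous.comp continuous_subtype_val)).inter
        (c.isOpen_Ω.preimage continuous_subtype_val)
    refine hopen.mem_nhds ⟨?_, hy⟩
    simp only [GraphChart.point, planeProj_graphMap]
    exact Metric.mem_ball_self hε
  · rw [c.area_apply measurableSet_ball]
    calc _ ≤ ∫⁻ v in Metric.ball u ε ∩ c.U, ENNReal.ofReal (graphDensity c.h u + 1) :=
          setLIntegral_mono' (measurableSet_ball.inter c.isOpen_U.measurableSet) fun v hv =>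
            ENNReal.ofReal_le_ofReal (le_of_lt (hball hv.1))
      _ ≤ ENNReal.ofReal (graphDensity c.h u + 1) * volume (Metric.ball u ε) := by
          rw [setLIntegral_const]
          exact mul_le_mul_right (measure_mono inter_subset_left) _
      _ < ∞ := ENNReal.mul_lt_top ENNReal.ofReal_lt_top measure_ball_lt_top⟩

/-- The density is at least `1`, so an open piece of a graph has at least the area of its shadow.
Uniqueness of the adjoint rests on this. -/
instance : Γ.area.IsOpenPosMeasure := ⟨fun O hO ⟨y, hyO⟩ hzero => by
  obtain ⟨O', hO', rfl⟩ := isOpen_induced_iff.1 hO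
  obtain ⟨c, hy⟩ := Γ.exists_graphChart y
  obtain ⟨u, hu, rfl⟩ := c.exists_point hy
  have hB : IsOpen (c.U ∩ graphMap c.k c.h ⁻¹' O') :=
    ContinuousOn.isOpen_inter_preimage (fun v hv =>
      (contDiffAt_graphMap (c.contDiffAt v hv)).continuousAt.continuousWithinAt) c.isOpen_U hO'
  have hsub : {y : Γ | planeProj c.k y ∈ c.U ∩ graphMap c.k c.h ⁻¹' O' ∧ (y : E3) ∈ c.Ω} ⊆
      Subtype.val ⁻¹' O' := by
    rintro x ⟨⟨-, hx⟩, hxΩ⟩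
    rwa [mem_preimage, c.graph_proj x ⟨x.2, hxΩ⟩] at hx
  have h1 := measure_mono_null hsub hzero
  rw [c.area_apply hB.measurableSet] at h1
  have h2 : volume (c.U ∩ graphMap c.k c.h ⁻¹' O') ≤
      ∫⁻ v in (c.U ∩ graphMap c.k c.h ⁻¹' O') ∩ c.U, ENNReal.ofReal (graphDensity c.h v) := by
    rw [inter_eq_left.2 (inter_subset_left : c.U ∩ graphMap c.k c.h ⁻¹' O' ⊆ c.U),
      ← one_mul (volume _), ← setLIntegral_const]
    refine setLIntegral_mono' hB.measurableSet fun v _ => ?_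
    rw [ENNReal.one_le_ofReal, graphDensity, Real.one_le_sqrt]
    nlinarith [sq_nonneg (pderiv 0 c.h v), sq_nonneg (pderiv 1 c.h v)]
  rw [h1] at h2
  exact (hB.measure_pos volume ⟨u, hu, hyO⟩).ne' (le_antisymm h2 zero_le)⟩

theorem integrable_of_continuous {η : Γ → ℝ} (hη : Continuous η) : Integrable η Γ.area :=
  hη.integrable_of_hasCompactSupport (HasCompactSupport.of_compactSpace η)

open scoped Manifold ContDiff in
variable (Γ) in
/-- A finite smooth partition of unity subordinate to graph charts. -/
theorem exists_partition : ∃ (s : Finset Γ) (c : s → Γ.GraphChart) (ρ : s → E3 → ℝ),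
    (∀ i, ContDiff ℝ ∞ (ρ i)) ∧ (∀ i, tsupport (ρ i) ⊆ (c i).Ω) ∧
    ∀ y : Γ, ∑ i, ρ i y = 1 := by
  choose c hc using Γ.exists_graphChart
  obtain ⟨s, hs⟩ := Γ.isCompact.elim_finite_subcover (fun y : Γ => (c y).Ω)
    (fun y => (c y).isOpen_Ω) fun x hx => mem_iUnion.2 ⟨⟨x, hx⟩, hc ⟨x, hx⟩⟩
  obtain ⟨ρ, hρ⟩ := SmoothPartitionOfUnity.exists_isSubordinate 𝓘(ℝ, E3)
    Γ.isCompact.isClosed (fun i : s => (c i).Ω) (fun i => (c i).isOpen_Ω) (fun x hx => by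
      obtain ⟨y, hy, hxy⟩ := mem_iUnion₂.1 (hs hx)
      exact mem_iUnion.2 ⟨⟨y, hy⟩, hxy⟩)
  refine ⟨s, fun i => c i, fun i => ρ i, fun i => (ρ i).contMDiff.contDiff, hρ, fun y => ?_⟩
  have := ρ.sum_eq_one y.2
  rwa [finsum_eq_sum_of_fintype] at this

/-- The divergence theorem on a closed surface. -/
theorem integral_div_eq_zero {W : Γ → E3} (hW : Γ.IsTangentialCk 1 W) :
    ∫ y, ∑ i, Γ.tangDeriv i (fun x => W x i) y ∂Γ.area = 0 := by
  obtain ⟨s, c, ρ, hρ, hsupp, hsum⟩ := Γ.exists_partition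
  have hρC : ∀ a, Γ.IsCk 1 fun y => ρ a y := fun a =>
    IsCk.of_contDiff ((hρ a).of_le (by exact_mod_cast le_top))
  have hρW : ∀ a, Γ.IsTangentialCk 1 fun y => ρ a y • W y := fun a =>
    ⟨fun i => (hρC a).mul (hW.isCk i), fun y => Submodule.smul_mem _ _ (hW.tangent y)⟩
  -- Since the `ρ a` sum to `1` on `Γ`, additivity alone suffices; derivatives of the cutoffs need
  -- not be computed.
  have hdec : ∀ y, ∑ i, Γ.tangDeriv i (fun x => W x i) y =
      ∑ a, ∑ i, Γ.tangDeriv i (fun x => (ρ a x • W x) i) y := fun y => by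
    rw [Finset.sum_comm]
    refine Finset.sum_congr rfl fun i _ => ?_
    rw [← tangDeriv_sum (fun a _ => (hρW a).isCk i)]
    congr 1
    ext x
    simp only [PiLp.smul_apply, smul_eq_mul]
    rw [← Finset.sum_mul, hsum, one_mul]
  simp only [hdec]
  rw [integral_finsetSum _ fun a _ => integrable_of_continuous
    (continuous_finsetSum _ fun i _ => continuous_tangDeriv ((hρW a).isCk i) i)]
  refine Finset.sum_eq_zero fun a _ => (c a).integral_div_eq_zero (hρW a) (isClosed_tsupport (ρ a))
    (hsupp a) fun y hy => ?_
  rw [image_eq_zero_of_notMem_tsupport hy, zero_smul]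

end ClosedSurface

/-! ### Existence and uniqueness of the formal adjoint -/

namespace ClosedSurface

variable {Γ : ClosedSurface}

theorem IsTangentialCk.continuous {k : ℕ} {X : Γ → E3} (hX : Γ.IsTangentialCk k X) :
    Continuous X :=
  continuous_of_components fun i => (hX.isCk i).continuous

theorem isCk_strainRate {X : Γ → E3} (hX : Γ.IsTangentialCk 2 X) (i j : Fin 3) :
    Γ.IsCk 1 fun y => Γ.strainRate X y i j := by
  have hG : ∀ a b, Γ.IsCk 1 fun y => Γ.gradMatrix X y a b := fun a b =>
    IsCk.tangDeriv (by norm_num) (hX.isCk b) a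
  simp only [strainRate, Matrix.mul_apply, Matrix.smul_apply, Matrix.add_apply,
    Matrix.transpose_apply, smul_eq_mul]
  exact IsCk.sum fun b _ => (IsCk.sum fun a _ => ((isCk_P i a).mono (by norm_num)).mul
    ((IsCk.const _).mul ((hG a b).add (hG b a)))).mul ((isCk_P b j).mono (by norm_num))

theorem isCk_smul_strainRate {g : Γ → ℝ} {X : Γ → E3} (hg : Γ.IsCk 1 g)
    (hX : Γ.IsTangentialCk 2 X) (i j : Fin 3) :
    Γ.IsCk 1 fun y => (g y • Γ.strainRate X y) i j :=
  hg.mul (isCk_strainRate hX i j)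

theorem isCkTensor_smul_defTensor {g : Γ → ℝ} {X : Γ → E3} (hg : Γ.IsCk 1 g)
    (hX : Γ.IsTangentialCk 2 X) : Γ.IsCkTensor 1 fun y => g y • Γ.defTensor X y := by
  intro Y Z hY hZ
  simp only [LinearMap.smul_apply, defTensor_apply_eq_strainRate, smul_eq_mul, dotProduct,
    Matrix.mulVec]
  exact hg.mul (IsCk.sum fun i _ => (hY.isCk i).mul
    (IsCk.sum fun j _ => (isCk_strainRate hX i j).mul (hZ.isCk j)))

/-- A continuous tangential field is determined by its integrals against tangential `C¹` fields. -/
theorem IsDefStar.unique {S : Γ.Tensor} {Z₁ Z₂ : Γ → E3} (h₁ : Γ.IsDefStar S Z₁)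
    (h₂ : Γ.IsDefStar S Z₂) : Z₁ = Z₂ := by
  by_contra hne
  obtain ⟨y₀, hy₀⟩ := Function.ne_iff.1 hne
  set v : E3 := Z₁ y₀ - Z₂ y₀
  have hv : v ≠ 0 := sub_ne_zero.2 hy₀
  have hD : Continuous fun y => Z₁ y - Z₂ y := h₁.continuous.sub h₂.continuous
  set φ : Γ → ℝ := fun y => inner ℝ (Z₁ y - Z₂ y) v
  have hφ : Continuous φ := hD.inner continuous_const
  have hφ₀ : 0 < φ y₀ := real_inner_self_pos.2 hv
  obtain ⟨O, hO, hOφ⟩ := isOpen_induced_iff.1 (isOpen_Ioi.preimage hφ : IsOpen (φ ⁻¹' Ioi 0))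
  have hyO : (y₀ : E3) ∈ O := by
    have : y₀ ∈ Subtype.val ⁻¹' O := by rw [hOφ]; exact hφ₀
    exact this
  obtain ⟨ρ, hρsupp, -, hρC, hρrange, hρ₀⟩ := exists_contDiff_tsupport_subset (n := 1)
    (hO.mem_nhds hyO)
  have hρk : Γ.IsCk 1 fun y => ρ y := IsCk.of_contDiff hρC
  have hρ0 : ∀ x, 0 ≤ ρ x := fun x => (hρrange ⟨x, rfl⟩).1
  have hnn : ∀ y : Γ, 0 ≤ ρ y * φ y := fun y => by
    by_cases hy : (y : E3) ∈ O
    · have : y ∈ φ ⁻¹' Ioi 0 := by rw [← hOφ]; exact hy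
      exact mul_nonneg (hρ0 _) (le_of_lt this)
    · rw [image_eq_zero_of_notMem_tsupport fun h => hy (hρsupp h), zero_mul]
  -- A bump function times the tangential part of the constant vector `v`, the difference of the two
  -- fields at `y₀`. Paired with tangential fields it acts like `ρ v`, so its pairing with `Z₁ - Z₂`
  -- is nonnegative and is positive at `y₀`.
  set Y : Γ → E3 := fun y => ρ y • Matrix.toEuclideanLin (Γ.P y) v
  have hY : Γ.IsTangentialCk 1 Y := by
    refine ⟨fun i => ?_, fun y => Submodule.smul_mem _ _ (Γ.toEuclideanLin_P_mem y v)⟩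
    refine hρk.mul (η := fun y => ρ y) (ζ := fun y => ∑ j, Γ.P y i j * v j) (IsCk.sum fun j _ => ?_)
    exact ((isCk_P i j).mono (by norm_num)).mul (IsCk.const (v j))
  have hin : ∀ Z : Γ → E3, (∀ y, Z y ∈ Γ.tangentPlane y) → ∀ y,
      inner ℝ (Z y) (Y y) = ρ y * inner ℝ (Z y) v := fun Z hZ y => by
    rw [real_inner_smul_right, real_inner_comm, inner_toEuclideanLin_P Γ y v (hZ y),
      real_inner_comm]
  have hint : ∀ Z : Γ → E3, Continuous Z → Integrable (fun y => inner ℝ (Z y) (Y y)) Γ.area :=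
    fun Z hZ => integrable_of_continuous (hZ.inner hY.continuous)
  have hzero : ∫ y, ρ y * φ y ∂Γ.area = 0 := by
    calc _ = ∫ y, (inner ℝ (Z₁ y) (Y y) - inner ℝ (Z₂ y) (Y y)) ∂Γ.area := by
          refine integral_congr_ae (Eventually.of_forall fun y => ?_)
          simp only [hin Z₁ h₁.tangent, hin Z₂ h₂.tangent, φ, inner_sub_left, mul_sub]
      _ = 0 := by
          rw [integral_sub (hint _ h₁.continuous) (hint _ h₂.continuous), h₁.integral_eq Y hY,
            h₂.integral_eq Y hY, sub_self]
  have hcont : Continuous fun y : Γ => ρ y * φ y := hρk.continuous.mul hφ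
  have hae := (integral_eq_zero_iff_of_nonneg hnn (integrable_of_continuous hcont)).1 hzero
  have heq := hcont.ae_eq_iff_eq Γ.area continuous_zero |>.1 hae
  have := congrFun heq y₀
  simp only [hρ₀, one_mul, Pi.zero_apply] at this
  exact hφ₀.ne' this

/-- `-P div_Γ[g D_Γ(X)]` has the defining property of `Def*(g Def X)`. -/
theorem isDefStar_neg_divMatrix {g : Γ → ℝ} {X : Γ → E3} (hg : Γ.IsCk 1 g)
    (hX : Γ.IsTangentialCk 2 X) :
    Γ.IsDefStar (fun y => g y • Γ.defTensor X y) fun y =>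
      -Matrix.toEuclideanLin (Γ.P y) (Γ.divMatrix (fun x => g x • Γ.strainRate X x) y) := by
  set A : Γ → Matrix (Fin 3) (Fin 3) ℝ := fun x => g x • Γ.strainRate X x
  have hA : ∀ i j, Γ.IsCk 1 fun y => A y i j := isCk_smul_strainRate hg hX
  refine ⟨?_, fun y => neg_mem (Γ.toEuclideanLin_P_mem y _), fun Y hY => ?_⟩
  · refine (continuous_of_components (X := fun y => Matrix.toEuclideanLin (Γ.P y)
      (Γ.divMatrix A y)) fun i => ?_).neg
    change Continuous fun y => ∑ j, Γ.P y i j * ∑ l, Γ.tangDeriv l (fun x => A x l j) y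
    exact continuous_finsetSum _ fun j _ => (isCk_P i j).continuous.mul
      (continuous_finsetSum _ fun l _ => continuous_tangDeriv (hA l j) l)
  -- `W = A Y` is tangential because `P A = A`; this permits the divergence theorem.
  set W : Γ → E3 := fun y => WithLp.toLp 2 fun i => ∑ j, A y i j * Y y j
  have hAY : ∀ i j, Γ.IsCk 1 fun y => A y i j * Y y j := fun i j => (hA i j).mul (hY.isCk j)
  have hW : Γ.IsTangentialCk 1 W := by
    refine ⟨fun i => (IsCk.sum (s := Finset.univ) fun j _ => hAY i j :
      Γ.IsCk 1 fun y => ∑ j, A y i j * Y y j), fun y => ?_⟩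
    have h1 : W y = Matrix.toEuclideanLin (Γ.P y) (W y) := by
      have h2 : Γ.P y * A y = A y := by rw [Matrix.mul_smul, P_mul_strainRate]
      have h3 : Γ.P y *ᵥ (A y *ᵥ (Y y).ofLp) = A y *ᵥ (Y y).ofLp := by
        rw [Matrix.mulVec_mulVec, h2]
      exact (congrArg (WithLp.toLp 2) h3).symm
    rw [h1]
    exact Γ.toEuclideanLin_P_mem y _
  -- Pointwise product rule for `div_Γ(A Y)`; the projection disappears against the tangential field
  -- `Y`.
  have hpt : ∀ y, inner ℝ (-Matrix.toEuclideanLin (Γ.P y) (Γ.divMatrix A y)) (Y y) =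
      Γ.tensorInner y (g y • Γ.defTensor X y) (Γ.defTensor Y y) -
        ∑ i, Γ.tangDeriv i (fun x => W x i) y := fun y => by
    have hdiv : ∀ i, Γ.tangDeriv i (fun x => W x i) y =
        ∑ j, (A y i j * Γ.gradMatrix Y y i j + Y y j * Γ.tangDeriv i (fun x => A x i j) y) :=
      fun i => by
        change Γ.tangDeriv i (fun x => ∑ j, A x i j * Y x j) y = _
        rw [tangDeriv_sum fun j _ => hAY i j]
        exact Finset.sum_congr rfl fun j _ => tangDeriv_mul (hA i j) (hY.isCk j) i y
    rw [inner_neg_left, inner_toEuclideanLin_P Γ y _ (hY.tangent y), tensorInner_defTensor]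
    simp only [hdiv, Finset.sum_add_distrib]
    have h4 : inner ℝ (Γ.divMatrix A y) (Y y) =
        ∑ i, ∑ j, Y y j * Γ.tangDeriv i (fun x => A x i j) y := by
      rw [E3.inner_eq_sum, Finset.sum_comm]
      refine Finset.sum_congr rfl fun j _ => ?_
      rw [← Finset.mul_sum, mul_comm]
      rfl
    rw [h4]
    simp only [A]
    ring
  have hθ : Integrable (fun y => Γ.tensorInner y (g y • Γ.defTensor X y) (Γ.defTensor Y y))
      Γ.area := by
    simp only [tensorInner_defTensor]
    exact integrable_of_continuous (continuous_finsetSum _ fun i _ => continuous_finsetSum _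
      fun j _ => (hA i j).continuous.mul (continuous_tangDeriv (hY.isCk j) i))
  simp only [hpt]
  rw [integral_sub hθ (integrable_of_continuous (continuous_finsetSum _ fun i _ =>
    continuous_tangDeriv (hW.isCk i) i)), integral_div_eq_zero hW, sub_zero]

theorem IsDefStar.defStar_eq {S : Γ.Tensor} {Z : Γ → E3} (h : Γ.IsDefStar S Z) :
    Γ.defStar S = Z := by
  have hex : ∃ Z, Γ.IsDefStar S Z := ⟨Z, h⟩
  rw [defStar, dif_pos hex]
  exact hex.choose_spec.unique h

end ClosedSurface

end

/-- For `g ∈ C¹(Γ)` and `X ∈ C²(Γ, TΓ)`: the matrix field `g D_Γ(X)` and the tensor `g Def X` are of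
class `C¹`, the formal adjoint `Def*` is well defined at `g Def X` (existence and uniqueness), and
`P div_Γ[g D_Γ(X)] = -Def*(g Def X)` on `Γ`. -/
theorem lemmaC9 (Γ : ClosedSurface) (g : Γ → ℝ) (X : Γ → E3)
    (hg : Γ.IsCk 1 g) (hX : Γ.IsTangentialCk 2 X) :
    (∀ i j, Γ.IsCk 1 (fun y => (g y • Γ.strainRate X y) i j)) ∧
    Γ.IsCkTensor 1 (fun y => g y • Γ.defTensor X y) ∧
    (∃! Z : Γ → E3, Γ.IsDefStar (fun y => g y • Γ.defTensor X y) Z) ∧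
    ∀ y : Γ, Matrix.toEuclideanLin (Γ.P y)
        (Γ.divMatrix (fun x => g x • Γ.strainRate X x) y) =
      -Γ.defStar (fun x => g x • Γ.defTensor X x) y := by
  have h := ClosedSurface.isDefStar_neg_divMatrix hg hX
  refine ⟨ClosedSurface.isCk_smul_strainRate hg hX, ClosedSurface.isCkTensor_smul_defTensor hg hX,
    ⟨_, h, fun Z hZ => hZ.unique h⟩, fun y => ?_⟩
  rw [h.defStar_eq, neg_neg]
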